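/- **Setting.** Let $d\ge 1$, and let $\Gamma_0$ be the set of finite subsets (configurations) $\eta$ of $\mathbb R^d$, with the σ-field for which $G:\Gamma_0\to\mathbb R$ is measurable if and only if $G(\{x_1,\dots,x_n\})=G^{(n)}(x_1,\dots,x_n)$ for symmetric Borel functions $G^{(n)}$ on $(\mathbb R^d)^n$, and with the Lebesgue–Poisson measure $\lambda$ given by $$\int_{\Gamma_0}G\,d\lambda=G(\emptyset)+\sum_{n\ge1}\frac1{n!}\int_{(\mathbb R^d)^n}G^{(n)}(x_1,\dots,x_n)\,dx_1\cdots dx_n .$$ For $\theta\in\mathbb R$ let $\mathcal K_\theta$ be the Banach space of (classes modulo $\lambda$-null sets of) measurable $k:\Gamma_0\to\mathbb R$ with $\|k\|_\theta=\operatorname{ess\,sup}_{\eta}|k(\eta)|e^{-\theta|\eta|}<\infty$, and let $\mathcal D_\theta=\{k\in\mathcal K_\theta:\exists C>0,\ |\eta|^2|k(\eta)|\le Ce^{\theta|\eta|}\text{ for a.e. }\eta\}$. Let $c_1(x,y;z)$, $c_2(x)$ and $\phi(x)$ be non-negative measurable functions with $c_1(x,y;z)=c_1(y,x;z)=c_1(x+u,y+u;z+u)$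 for all $x,y,z,u\in\mathbb R^d$, and suppose that $$\langle c_1\rangle=\iint c_1(x_1,x_2;x_3)\,dx_i\,dx_j<\infty,\quad \sup_{x,y}\int c_1(x,y;z)\,dz<\infty,\quad \langle c_2\rangle=\int c_2\,dx<\infty,\quad \langle\phi\rangle=\int\phi\,dx<\infty,\quad \sup\phi<\infty$$ (by translation invariance, $\langle c_1\rangle$ depends neither on the choice of $i\neq j$ in $\{1,2,3\}$ nor on the remaining variable). Define $(Q_yk)(\eta)=\int_{\Gamma_0}k(\eta\cup\xi)\prod_{u\in\xi}(e^{-\phi(y-u)}-1)\,\lambda(d\xi)$ and $$\begin{aligned}(L^\Delta k)(\eta)={}&\tfrac12\iint\sum_{z\in\eta}c_1(x,y;z)\,k(\eta\setminus z\cup\{x,y\})\,dx\,dy-\tfrac12\iint\sum_{x\in\eta}c_1(x,y;z)\,k(\eta\cup y)\,dy\,dz\\&-\tfrac12\iint\sum_{y\in\eta}c_1(x,y;z)\,k(\eta\cup x)\,dx\,dz-k(\eta)\int\sum_{\{x,y\}\subset\eta}c_1(x,y;z)\,dz\\&+\int\sum_{y\in\eta}c_2(x-y)\prod_{u\in\eta\setminus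 y}e^{-\phi(y-u)}\,(Q_yk)(\eta\setminus y\cup x)\,dx-\int\sum_{x\in\eta}c_2(x-y)\prod_{u\in\eta\setminus x}e^{-\phi(y-u)}\,(Q_yk)(\eta)\,dy .\end{aligned}$$ Put $\beta(\theta)=\tfrac32\langle c_1\rangle e^\theta+2\exp(\langle\phi\rangle e^\theta)\langle c_2\rangle$ and, for $\theta'>\theta$, $T(\theta',\theta)=(\theta'-\theta)/\beta(\theta')$, which is $+\infty$ if $\beta(\theta')=0$. **Theorem.** For all $\alpha_0\in\mathbb R$, $\alpha_*>\alpha_0$ and $k_0\in\mathcal K_{\alpha_0}$, the problem $$\frac{d}{dt}k_t=L^\Delta k_t,\qquad k_t|_{t=0}=k_0,$$ has a unique classical solution in $\mathcal K_{\alpha_*}$ on $[0,T(\alpha_*,\alpha_0))$; that is, there is exactly one map $t\mapsto k_t\in\mathcal D_{\alpha_*}$ on $[0,T(\alpha_*,\alpha_0))$ that is continuous in the norm of $\mathcal K_{\alpha_*}$, is continuously differentiable in $\mathcal K_{\alpha_*}$ on $(0,T(\alpha_*,\alpha_0))$, and satisfies the equation on $(0,T(\alpha_*,\alpha_0))$ and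 the initial condition. -/

import Mathlib

open MeasureTheory Set
open scoped ENNReal

noncomputable section

namespace JumpCoalescence

/-- Euclidean space `ℝ^d`, with its Lebesgue measure. -/
abbrev Space (d : ℕ) : Type := EuclideanSpace ℝ (Fin d)

/-- The set `Γ₀` of finite configurations `η ⊂ ℝ^d`. (A one-field structure, since Mathlib puts on
`Finset` a σ-field that does not take that of the underlying space into account.) -/
@[ext]
structure Config (d : ℕ) : Type where
  points : Finset (Space d)

/-- The number of points `|η|`. -/
def Config.card {d : ℕ} (η : Config d) : ℕ := η.points.card

open Classical in
/-- The map `(x₁, …, xₙ) ↦ {x₁, …, xₙ}`. -/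
def ofTuple {d : ℕ} (n : ℕ) (x : Fin n → Space d) : Config d :=
  ⟨Finset.univ.image x⟩

/-- The σ-field on `Γ₀`: a set (a function) is measurable if and only if, for every `n`, it
becomes a symmetric Borel set (function) on `(ℝ^d)^n` after composition with
`(x₁, …, xₙ) ↦ {x₁, …, xₙ}`. Tuples with repeated entries add no condition: each of the finitely
many diagonal strata is a Borel set on which this map factors, through a Borel map, over tuples of
fewer, distinct points. -/
instance instMeasurableSpaceConfig (d : ℕ) : MeasurableSpace (Config d) :=
  ⨅ n : ℕ, MeasurableSpace.map (ofTuple (d := d) n) inferInstance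

/-- The Lebesgue-Poisson measure
`∫ G dλ = G(∅) + ∑_{n ≥ 1} (1/n!) ∫ G({x₁, …, xₙ}) dx₁ ⋯ dxₙ` (for `d ≥ 1`, tuples with repeated
entries form a null set). -/
def lebesguePoisson (d : ℕ) : Measure (Config d) :=
  Measure.sum fun n : ℕ =>
    ((n.factorial : ℝ≥0∞)⁻¹) • (volume : Measure (Fin n → Space d)).map (ofTuple n)

/-- The space `𝒦_θ` of (classes modulo `λ`-null sets of) measurable functions `k : Γ₀ → ℝ` such
that `e^{-θ|η|} k(η)` is essentially bounded. -/
def KSpace (d : ℕ) (θ : ℝ) : Submodule ℝ (Config d →ₘ[lebesguePoisson d] ℝ) where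
  carrier := {k | MemLp (fun η : Config d => Real.exp (-θ * η.card) * k η) ∞ (lebesguePoisson d)}
  zero_mem' := by
    refine (memLp_congr_ae ?_).2 (MemLp.zero' (α := Config d) (ε := ℝ))
    filter_upwards [AEEqFun.coeFn_zero (α := Config d) (β := ℝ) (μ := lebesguePoisson d)] with η h
    simp [h]
  add_mem' := by
    intro a b ha hb
    refine (memLp_congr_ae ?_).2 (MemLp.add ha hb)
    filter_upwards [AEEqFun.coeFn_add a b] with η h
    simp [h, mul_add]
  smul_mem' := by
    intro c a ha
    refine (memLp_congr_ae ?_).2 (MemLp.const_smul ha c)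
    filter_upwards [AEEqFun.coeFn_smul c a] with η h
    simp [h, mul_left_comm]

theorem KSpace.memLp {d : ℕ} {θ : ℝ} (k : KSpace d θ) :
    MemLp (fun η : Config d => Real.exp (-θ * η.card) * k.1 η) ∞ (lebesguePoisson d) := k.2

/-- The linear map `k ↦ e^{-θ|·|} k` from `𝒦_θ` to `L^∞(Γ₀, λ)`. -/
def KSpace.toLinf (d : ℕ) (θ : ℝ) : KSpace d θ →ₗ[ℝ] Lp ℝ ∞ (lebesguePoisson d) where
  toFun k := MemLp.toLp (fun η : Config d => Real.exp (-θ * η.card) * k.1 η) (KSpace.memLp k)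
  map_add' a b := by
    rw [← MemLp.toLp_add (KSpace.memLp a) (KSpace.memLp b)]
    refine MemLp.toLp_congr _ _ ?_
    filter_upwards [AEEqFun.coeFn_add a.1 b.1] with η h
    simp [h, mul_add]
  map_smul' c a := by
    rw [RingHom.id_apply, ← MemLp.toLp_const_smul c (KSpace.memLp a)]
    refine MemLp.toLp_congr _ _ ?_
    filter_upwards [AEEqFun.coeFn_smul c a.1] with η h
    simp [h, mul_left_comm]

theorem KSpace.toLinf_injective (d : ℕ) (θ : ℝ) : Function.Injective (KSpace.toLinf d θ) := by
  intro a b h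
  apply Subtype.ext
  apply AEEqFun.ext
  have h' := (MemLp.toLp_eq_toLp_iff (KSpace.memLp a) (KSpace.memLp b)).1 h
  filter_upwards [h'] with η hη
  exact mul_left_cancel₀ (Real.exp_ne_zero _) hη

/-- The norm `‖k‖_θ = ess sup_η e^{-θ|η|} |k(η)|` of `𝒦_θ`. -/
instance KSpace.instNormedAddCommGroup (d : ℕ) (θ : ℝ) : NormedAddCommGroup (KSpace d θ) :=
  NormedAddCommGroup.induced (KSpace d θ) (Lp ℝ ∞ (lebesguePoisson d)) (KSpace.toLinf d θ)
    (KSpace.toLinf_injective d θ)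

instance KSpace.instNormedSpace (d : ℕ) (θ : ℝ) : NormedSpace ℝ (KSpace d θ) :=
  NormedSpace.induced ℝ (KSpace d θ) (Lp ℝ ∞ (lebesguePoisson d)) (KSpace.toLinf d θ)

theorem KSpace.norm_eq (d : ℕ) (θ : ℝ) (k : KSpace d θ) :
    ‖k‖ = (essSup (fun η : Config d => ‖Real.exp (-θ * η.card) * k.1 η‖ₑ)
      (lebesguePoisson d)).toReal := by
  change ‖MemLp.toLp (fun η : Config d => Real.exp (-θ * η.card) * k.1 η) (KSpace.memLp k)‖ = _
  rw [Lp.norm_toLp, eLpNorm_exponent_top, eLpNormEssSup]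

/-- The domain `𝒟_θ` of those `k ∈ 𝒦_θ` for which `|η|² |k(η)| ≤ C e^{θ|η|}` for some `C > 0`. -/
def KDomain (d : ℕ) (θ : ℝ) : Set (KSpace d θ) :=
  {k | ∃ C : ℝ, 0 < C ∧
    ∀ᵐ η ∂(lebesguePoisson d), (η.card : ℝ) ^ 2 * |k.1 η| ≤ C * Real.exp (θ * η.card)}

section Model

variable {d : ℕ}

/-- The standing assumptions on the coalescence kernel `c₁(x, y; z)`, the jump kernel `c₂` and the
repulsion potential `φ`. By translation invariance, the integral of `c₁` over any two of its three
variables has one and the same value, whichever they are and whatever the third one is; so its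
finiteness is stated for the first two variables at `z = 0`. -/
structure ModelAssumptions (c₁ : Space d → Space d → Space d → ℝ) (c₂ φ : Space d → ℝ) :
    Prop where
  measurable_c₁ : Measurable fun p : Space d × Space d × Space d => c₁ p.1 p.2.1 p.2.2
  c₁_nonneg : ∀ x y z, 0 ≤ c₁ x y z
  c₁_symm : ∀ x y z, c₁ x y z = c₁ y x z
  c₁_translate : ∀ x y z u, c₁ (x + u) (y + u) (z + u) = c₁ x y z
  c₁_integrable : Integrable fun p : Space d × Space d => c₁ p.1 p.2 0
  c₁_max : ⨆ x, ⨆ y, ∫⁻ z, ENNReal.ofReal (c₁ x y z) < ∞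
  measurable_c₂ : Measurable c₂
  c₂_nonneg : ∀ x, 0 ≤ c₂ x
  c₂_integrable : Integrable c₂
  measurable_φ : Measurable φ
  φ_nonneg : ∀ x, 0 ≤ φ x
  φ_integrable : Integrable φ
  φ_bounded : BddAbove (range φ)

/-- `⟨c₁⟩`, the integral of `c₁` over two of its variables. -/
def c₁Integral (c₁ : Space d → Space d → Space d → ℝ) : ℝ :=
  ∫ p : Space d × Space d, c₁ p.1 p.2 0

/-- `β(θ) = (3/2) ⟨c₁⟩ e^θ + 2 exp(⟨φ⟩ e^θ) ⟨c₂⟩`. -/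
def β (c₁ : Space d → Space d → Space d → ℝ) (c₂ φ : Space d → ℝ) (θ : ℝ) : ℝ :=
  3 / 2 * c₁Integral c₁ * Real.exp θ + 2 * Real.exp ((∫ x, φ x) * Real.exp θ) * ∫ x, c₂ x

/-- `T(θ', θ) = (θ' - θ) / β(θ')` for `θ' > θ`; it is `∞` if `β(θ') = 0`. -/
def existenceTime (c₁ : Space d → Space d → Space d → ℝ) (c₂ φ : Space d → ℝ) (θ' θ : ℝ) : ℝ≥0∞ :=
  ENNReal.ofReal (θ' - θ) / ENNReal.ofReal (β c₁ c₂ φ θ')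

/-- `Ψ(η) = ∫ ∑_{{x, y} ⊂ η} c₁(x, y; z) dz`, the sum over unordered pairs of distinct points being
half of the sum over ordered ones. -/
def Ψ (c₁ : Space d → Space d → Space d → ℝ) (η : Config d) : ℝ :=
  open Classical in ∫ z, (1 / 2 : ℝ) * ∑ p ∈ η.points.offDiag, c₁ p.1 p.2 z

/-- `(L₁₁ k)(η) = (1/2) ∫∫ ∑_{z ∈ η} c₁(x, y; z) k(η \ z ∪ {x, y}) dx dy`. -/
def L₁₁ (c₁ : Space d → Space d → Space d → ℝ) (k : Config d → ℝ) (η : Config d) : ℝ :=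
  open Classical in
  (1 / 2 : ℝ) * ∫ p : Space d × Space d,
    ∑ z ∈ η.points, c₁ p.1 p.2 z * k ⟨(η.points \ {z}) ∪ {p.1, p.2}⟩

/-- `(L₁₂ k)(η) = -(1/2) ∫∫ ∑_{x ∈ η} c₁(x, y; z) k(η ∪ y) dy dz`. -/
def L₁₂ (c₁ : Space d → Space d → Space d → ℝ) (k : Config d → ℝ) (η : Config d) : ℝ :=
  open Classical in
  -((1 / 2 : ℝ) * ∫ p : Space d × Space d, ∑ x ∈ η.points, c₁ x p.1 p.2 * k ⟨η.points ∪ {p.1}⟩)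

/-- `(L₁₃ k)(η) = -(1/2) ∫∫ ∑_{y ∈ η} c₁(x, y; z) k(η ∪ x) dx dz`. -/
def L₁₃ (c₁ : Space d → Space d → Space d → ℝ) (k : Config d → ℝ) (η : Config d) : ℝ :=
  open Classical in
  -((1 / 2 : ℝ) * ∫ p : Space d × Space d, ∑ y ∈ η.points, c₁ p.1 y p.2 * k ⟨η.points ∪ {p.1}⟩)

/-- `(L₁₄ k)(η) = -Ψ(η) k(η)`. -/
def L₁₄ (c₁ : Space d → Space d → Space d → ℝ) (k : Config d → ℝ) (η : Config d) : ℝ :=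
  -(Ψ c₁ η * k η)

/-- `(Q_y k)(η) = ∫ k(η ∪ ξ) ∏_{u ∈ ξ} (e^{-φ(y - u)} - 1) λ(dξ)`. -/
def Q (φ : Space d → ℝ) (y : Space d) (k : Config d → ℝ) (η : Config d) : ℝ :=
  open Classical in
  ∫ ξ, k ⟨η.points ∪ ξ.points⟩ * ∏ u ∈ ξ.points, (Real.exp (-φ (y - u)) - 1) ∂(lebesguePoisson d)

/-- `(L₂₁ k)(η) = ∫ ∑_{y ∈ η} c₂(x - y) ∏_{u ∈ η \ y} e^{-φ(y - u)} (Q_y k)(η \ y ∪ x) dx`. -/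
def L₂₁ (c₂ φ : Space d → ℝ) (k : Config d → ℝ) (η : Config d) : ℝ :=
  open Classical in
  ∫ x, ∑ y ∈ η.points, c₂ (x - y) * (∏ u ∈ η.points \ {y}, Real.exp (-φ (y - u))) *
    Q φ y k ⟨(η.points \ {y}) ∪ {x}⟩

/-- `(L₂₂ k)(η) = -∫ ∑_{x ∈ η} c₂(x - y) ∏_{u ∈ η \ x} e^{-φ(y - u)} (Q_y k)(η) dy`. -/
def L₂₂ (c₂ φ : Space d → ℝ) (k : Config d → ℝ) (η : Config d) : ℝ :=
  open Classical in
  -∫ y, ∑ x ∈ η.points, c₂ (x - y) * (∏ u ∈ η.points \ {x}, Real.exp (-φ (y - u))) * Q φ y k η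

/-- The operator `L^Δ` of the jump-and-coalescence model, acting on functions on `Γ₀`. For `k` in
some `𝒦_θ`, all the integrals converge absolutely for `λ`-almost every `η`, and the class of the
result modulo `λ`-null sets depends only on that of `k`. -/
def LΔ (c₁ : Space d → Space d → Space d → ℝ) (c₂ φ : Space d → ℝ) (k : Config d → ℝ)
    (η : Config d) : ℝ :=
  L₁₁ c₁ k η + L₁₂ c₁ k η + L₁₃ c₁ k η + L₁₄ c₁ k η + L₂₁ c₂ φ k η + L₂₂ c₂ φ k η

/-- `k` is a classical solution of `dk_t/dt = L^Δ k_t`, `k_t|_{t=0} = k₀` in the Banach space `𝒦_θ`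
on `[0, τ)`: it is continuous on `[0, τ)` with values in `𝒟_θ`, continuously differentiable in
`𝒦_θ` on `(0, τ)`, and satisfies both equations (as elements of `𝒦_θ`, that is, up to `λ`-null
sets). Only the values of `k` on `[0, τ)` matter. -/
structure IsClassicalSolution (c₁ : Space d → Space d → Space d → ℝ) (c₂ φ : Space d → ℝ) (θ : ℝ)
    (τ : ℝ≥0∞) (k₀ : Config d →ₘ[lebesguePoisson d] ℝ) (k : ℝ → KSpace d θ) : Prop where
  continuousOn : ContinuousOn k {t | 0 ≤ t ∧ ENNReal.ofReal t < τ}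
  mem_domain : ∀ t, 0 ≤ t → ENNReal.ofReal t < τ → k t ∈ KDomain d θ
  differentiableAt : ∀ t, 0 < t → ENNReal.ofReal t < τ → DifferentiableAt ℝ k t
  continuousOn_deriv : ContinuousOn (deriv k) {t | 0 < t ∧ ENNReal.ofReal t < τ}
  equation : ∀ t, 0 < t → ENNReal.ofReal t < τ →
    (deriv k t).1 =ᵐ[lebesguePoisson d] LΔ c₁ c₂ φ (k t).1
  initial : (k 0).1 = k₀

end Model

end JumpCoalescence

end

open JumpCoalescence

noncomputable section

namespace JumpCoalescence

open Filter Topology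

/-! ### The σ-field on configurations and measurability with parameters -/

section

variable {d : ℕ} {P : Type*} [MeasurableSpace P] {ι κ : Type*} [Fintype ι] [Fintype κ]

/-! Write L^Δ = -Ψ + B, where Ψ ≥ 0 acts by multiplication and B (`offDiagonal`) collects the
integral terms. If |k| ≤ C e^{θ|·|}, counting the points in each term and using ∫ ∏ f dλ = exp ∫ f
for Q_y gives |Bk|(η) ≤ C β(θ) |η| e^{θ|η|} (`abs_offDiagonal_le`). Thus B costs a factor |η|, which
no single 𝒦_θ controls; an exponent that grows with time pays for it.

Existence. The Duhamel equation u_t = e^{-tΨ}(k₀ + ∫₀ᵗ e^{sΨ} B u_s ds) is solved by Picard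
iteration in the weights e^{(α+bs)|η|}. Since ∫₀ᵗ n e^{(α+bs)n} ds ≤ e^{(α+bt)n}/b, and the factors
e^{±Ψ} cancel favourably, the Duhamel map on [0, T] has Lipschitz constant β(α+bT)/b
(`abs_picardMap_sub_le`). With b slightly above β(α') this is a contraction, provided α + bT < α';
such a b exists exactly when T β(α') < α' - α, that is, T below the existence time. All of this is
done at every configuration for a representative of k₀ bounded everywhere, so the solution is an
actual function of (t, η).

Regularity. On each compact time interval the solution stays in a 𝒦_θ with θ < α' strictly. The gap
absorbs the factor |η|² lost by L^Δ, so u and then L^Δ u are Lipschitz in time in the larger norm; a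
pointwise Taylor estimate becomes norm differentiability in 𝒦_{α'} (`hasDerivAt_toKSpace`).

Uniqueness. A competing solution is known to lie only in 𝒦_{α'} itself, with no gap. For the
difference w of two solutions, the norm of its N-point part is followed in time. An Euler step shows
that -Ψ does not increase it, so a bound |w_s| ≤ m e^{(θ+r(s-t₀))|η|} controls its growth rate and,
for r ≥ 2β(θ+1) on an interval of length at most 1/r, improves to the same bound with m/2
(`ae_le_half_of_ae_le`). Iterating gives w = 0, and finitely many such intervals reach any time. -/

open Classical in
/-- The configuration `{x i | i ∈ ι}` of a finite family of points. -/
def cfg (x : ι → Space d) : Config d := ⟨Finset.univ.image x⟩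

theorem cfg_comp_equiv (e : κ ≃ ι) (x : ι → Space d) : cfg (x ∘ e) = cfg x := by
  ext a
  simp only [cfg, Finset.mem_image, Finset.mem_univ, true_and, Function.comp_apply]
  exact e.exists_congr_left.trans (by simp)

theorem cfg_eq_of_range_eq {x : ι → Space d} {y : κ → Space d} (h : range x = range y) :
    cfg x = cfg y := by
  ext a
  simpa [cfg] using Set.ext_iff.1 h a

theorem card_cfg {x : ι → Space d} (hx : Function.Injective x) :
    (cfg x).card = Fintype.card ι := by
  classical
  simp [cfg, Config.card, Finset.card_image_of_injective _ hx]

theorem measurable_ofTuple (n : ℕ) : Measurable (ofTuple (d := d) n) :=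
  fun _ hs => (MeasurableSpace.measurableSet_iInf.1 hs) n

theorem measurable_cfg : Measurable (cfg (d := d) : (ι → Space d) → Config d) := by
  have h : (cfg (d := d) : (ι → Space d) → Config d) =
      ofTuple (Fintype.card ι) ∘ fun x => x ∘ (Fintype.equivFin ι).symm := by
    ext1 x
    exact (cfg_comp_equiv (Fintype.equivFin ι).symm x).symm
  rw [h]
  exact (measurable_ofTuple _).comp (measurable_pi_lambda _ fun i => measurable_pi_apply _)

theorem measurableSet_config {A : Set (Config d)}
    (h : ∀ n, MeasurableSet (ofTuple (d := d) n ⁻¹' A)) : MeasurableSet A :=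
  MeasurableSpace.measurableSet_iInf.2 h

theorem measurable_config {β : Type*} [MeasurableSpace β] {f : Config d → β}
    (h : ∀ n, Measurable fun x => f (ofTuple n x)) : Measurable f :=
  fun _ hs => measurableSet_config fun n => h n hs

theorem exists_injective_ofTuple (η : Config d) :
    ∃ x : Fin η.card → Space d, Function.Injective x ∧ ofTuple _ x = η := by
  classical
  refine ⟨fun i => (η.points.equivFin.symm i : Space d),
    fun i j h => η.points.equivFin.symm.injective (Subtype.ext h), ?_⟩
  ext a
  simp only [ofTuple, Finset.mem_image, Finset.mem_univ, true_and]
  constructor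
  · rintro ⟨i, rfl⟩
    exact (η.points.equivFin.symm i).2
  · intro ha
    exact ⟨η.points.equivFin ⟨a, ha⟩, by simp⟩

theorem exists_injective_section (x : ι → Space d) :
    ∃ (m : ℕ) (σ : Fin m → ι), Function.Injective (x ∘ σ) ∧ ∀ i, ∃ j, x i = x (σ j) := by
  obtain ⟨y, hy, hxy⟩ := exists_injective_ofTuple (cfg x)
  have h : ∀ j, ∃ i, x i = y j := by
    intro j
    have : y j ∈ (cfg x).points := by
      rw [← hxy]
      exact Finset.mem_image_of_mem _ (Finset.mem_univ _)
    simpa [cfg] using this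
  choose σ hσ using h
  refine ⟨_, σ, ?_, fun i => ?_⟩
  · rwa [show x ∘ σ = y from funext hσ]
  · have : x i ∈ (ofTuple _ y).points := by
      rw [hxy]
      exact Finset.mem_image_of_mem _ (Finset.mem_univ _)
    obtain ⟨j, -, hj⟩ := Finset.mem_image.1 this
    exact ⟨j, by rw [hσ, hj]⟩

theorem measurableSet_injective : MeasurableSet {x : ι → Space d | Function.Injective x} := by
  have : {x : ι → Space d | Function.Injective x} =
      ⋂ i, ⋂ j, {x : ι → Space d | x i = x j → i = j} := by
    ext x
    simp [Function.Injective]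
  rw [this]
  refine MeasurableSet.iInter fun i => MeasurableSet.iInter fun j => ?_
  by_cases hij : i = j
  · simp [hij]
  · simp only [hij, imp_false]
    exact (measurableSet_eq_fun (measurable_pi_apply i) (measurable_pi_apply j)).compl

/-- Measurability on the distinct tuples implies measurability on all tuples. -/
theorem measurableSet_tuple_of_injective {A : Set (P × Config d)}
    (h : ∀ n, ∃ B : Set (P × (Fin n → Space d)), MeasurableSet B ∧
      ∀ p x, Function.Injective x → ((p, ofTuple n x) ∈ A ↔ (p, x) ∈ B)) (n : ℕ) :
    MeasurableSet {q : P × (Fin n → Space d) | (q.1, ofTuple n q.2) ∈ A} := by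
  choose B hB hAB using h
  -- Cut the tuple space by a choice σ of one index for each distinct value. On each of the
  -- countably many pieces the configuration is that of the injective tuple `x ∘ σ`, where B decides
  -- membership.
  have : {q : P × (Fin n → Space d) | (q.1, ofTuple n q.2) ∈ A} =
      ⋃ (m : ℕ), ⋃ (σ : Fin m → Fin n),
        {q | Function.Injective (q.2 ∘ σ)} ∩ {q | ∀ i, ∃ j, q.2 i = q.2 (σ j)} ∩
          {q | (q.1, q.2 ∘ σ) ∈ B m} := by
    have key : ∀ (p : P) (x : Fin n → Space d) (m : ℕ) (σ : Fin m → Fin n),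
        Function.Injective (x ∘ σ) → (∀ i, ∃ j, x i = x (σ j)) →
        ((p, ofTuple n x) ∈ A ↔ (p, x ∘ σ) ∈ B m) := by
      intro p x m σ h1 h2
      rw [← hAB m p _ h1]
      have : ofTuple n x = ofTuple m (x ∘ σ) := by
        refine cfg_eq_of_range_eq ?_
        ext a
        constructor
        · rintro ⟨i, rfl⟩
          obtain ⟨j, hj⟩ := h2 i
          exact ⟨j, hj.symm⟩
        · rintro ⟨j, rfl⟩
          exact ⟨σ j, rfl⟩
      rw [this]
    ext ⟨p, x⟩
    simp only [mem_ofPred_eq, mem_iUnion, mem_inter_iff]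
    constructor
    · intro hA
      obtain ⟨m, σ, h1, h2⟩ := exists_injective_section x
      exact ⟨m, σ, ⟨h1, h2⟩, (key p x m σ h1 h2).1 hA⟩
    · rintro ⟨m, σ, ⟨h1, h2⟩, h3⟩
      exact (key p x m σ h1 h2).2 h3
  rw [this]
  refine MeasurableSet.iUnion fun m => MeasurableSet.iUnion fun σ => ?_
  have hσ : Measurable fun q : P × (Fin n → Space d) => q.2 ∘ σ :=
    measurable_pi_lambda _ fun i => (measurable_pi_apply (σ i)).comp measurable_snd
  refine ((hσ measurableSet_injective).inter ?_).inter
    ((measurable_fst.prodMk hσ) (hB m))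
  simp only [ofPred_forall, ofPred_exists]
  exact MeasurableSet.iInter fun i => MeasurableSet.iUnion fun j =>
    measurableSet_eq_fun ((measurable_pi_apply i).comp measurable_snd)
      ((measurable_pi_apply (σ j)).comp measurable_snd)

/-- A family of functions on configurations depends measurably on its parameter and on the
points of the configuration. -/
def JointlyMeasurable (u : P → Config d → ℝ) : Prop :=
  ∀ n, Measurable fun q : P × (Fin n → Space d) => u q.1 (ofTuple n q.2)

theorem JointlyMeasurable.of_injective {u : P → Config d → ℝ}
    (h : ∀ n, ∃ g : P × (Fin n → Space d) → ℝ, Measurable g ∧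
      ∀ p x, Function.Injective x → u p (ofTuple n x) = g (p, x)) : JointlyMeasurable u := by
  intro n s hs
  refine measurableSet_tuple_of_injective (A := {q : P × Config d | u q.1 q.2 ∈ s}) (fun m => ?_) n
  obtain ⟨g, hg, hug⟩ := h m
  exact ⟨g ⁻¹' s, hg hs, fun p x hx => by simp [hug p x hx]⟩

theorem JointlyMeasurable.comp_cfg {u : P → Config d → ℝ} (hu : JointlyMeasurable u)
    {R : Type*} [MeasurableSpace R] {a : R → P} {b : R → ι → Space d} (ha : Measurable a)
    (hb : Measurable b) : Measurable fun r => u (a r) (cfg (b r)) := by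
  have h : (fun r => u (a r) (cfg (b r))) = (fun q : P × (Fin (Fintype.card ι) → Space d) =>
      u q.1 (ofTuple _ q.2)) ∘ fun r => (a r, b r ∘ (Fintype.equivFin ι).symm) := by
    ext1 r
    exact congrArg (u (a r)) (cfg_comp_equiv (Fintype.equivFin ι).symm (b r)).symm
  rw [h]
  exact (hu _).comp (ha.prodMk (measurable_pi_lambda _ fun i => (measurable_pi_apply _).comp hb))

theorem JointlyMeasurable.measurable {u : P → Config d → ℝ} (hu : JointlyMeasurable u) (p : P) :
    Measurable (u p) :=
  measurable_config fun n => (hu n).comp measurable_prodMk_left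

theorem JointlyMeasurable.measurable_left {u : P → Config d → ℝ} (hu : JointlyMeasurable u)
    (η : Config d) : Measurable fun p => u p η := by
  obtain ⟨x, -, hx⟩ := exists_injective_ofTuple η
  have h := (hu _).comp (measurable_prodMk_right (y := x))
  simpa only [Function.comp_def, hx] using h

theorem JointlyMeasurable.comp {u : P → Config d → ℝ} (hu : JointlyMeasurable u)
    {R : Type*} [MeasurableSpace R] {a : R → P} (ha : Measurable a) :
    JointlyMeasurable fun r => u (a r) :=
  fun n => (hu n).comp ((ha.comp measurable_fst).prodMk measurable_snd)

theorem JointlyMeasurable.of_measurable {k : Config d → ℝ} (hk : Measurable k) :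
    JointlyMeasurable fun _ : P => k :=
  fun n => hk.comp ((measurable_ofTuple n).comp measurable_snd)

theorem JointlyMeasurable.mul {u v : P → Config d → ℝ} (hu : JointlyMeasurable u)
    (hv : JointlyMeasurable v) : JointlyMeasurable fun p η => u p η * v p η :=
  fun n => (hu n).mul (hv n)

/-- The Lebesgue-Poisson measure, before the order of the points is forgotten. -/
def tupleMeasure (d : ℕ) : Measure (Σ n : ℕ, (Fin n → Space d)) :=
  Measure.sum fun n : ℕ =>
    ((n.factorial : ℝ≥0∞)⁻¹) • (volume : Measure (Fin n → Space d)).map (fun x => ⟨n, x⟩)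

theorem measurable_sigma_ofTuple :
    Measurable fun ω : Σ n : ℕ, (Fin n → Space d) => ofTuple ω.1 ω.2 :=
  fun _ hs => MeasurableSpace.measurableSet_iInf.2 fun n => measurable_ofTuple n hs

theorem measurable_sigma_mk (n : ℕ) :
    Measurable (fun x => ⟨n, x⟩ : (Fin n → Space d) → Σ n : ℕ, (Fin n → Space d)) :=
  fun _ hs => (MeasurableSpace.measurableSet_iInf.1 hs) n

instance : SFinite (tupleMeasure d) := by
  have (n : ℕ) : SFinite (((n.factorial : ℝ≥0∞)⁻¹) •
      (volume : Measure (Fin n → Space d)).map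
        fun x => (⟨n, x⟩ : Σ n : ℕ, (Fin n → Space d))) := inferInstance
  unfold tupleMeasure
  infer_instance

theorem lebesguePoisson_eq_map (d : ℕ) :
    lebesguePoisson d = (tupleMeasure d).map fun ω => ofTuple ω.1 ω.2 := by
  rw [lebesguePoisson, tupleMeasure, Measure.map_sum measurable_sigma_ofTuple.aemeasurable]
  congr 1
  ext1 n
  rw [Measure.map_smul, Measure.map_map measurable_sigma_ofTuple (measurable_sigma_mk n)]
  rfl

/-- Each inclusion of the n-tuples into the sigma type is a measurable embedding, so a preimage is a
countable union of measurable images. -/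
theorem measurable_prod_sigma {β : Type*} [MeasurableSpace β]
    {f : P × (Σ n : ℕ, (Fin n → Space d)) → β}
    (h : ∀ n, Measurable fun q : P × (Fin n → Space d) => f (q.1, ⟨n, q.2⟩)) : Measurable f := by
  intro s hs
  have hemb : ∀ n, MeasurableEmbedding
      (fun x => ⟨n, x⟩ : (Fin n → Space d) → Σ n : ℕ, (Fin n → Space d)) := by
    intro n
    have hinj : Function.Injective
        (fun x => ⟨n, x⟩ : (Fin n → Space d) → Σ n : ℕ, (Fin n → Space d)) := by
      intro x y h
      simpa using h
    refine ⟨hinj, measurable_sigma_mk n, fun s hs => ?_⟩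
    refine MeasurableSpace.measurableSet_iInf.2 fun m => ?_
    by_cases hmn : n = m
    · subst hmn
      change MeasurableSet ((fun x => (⟨n, x⟩ : Σ n : ℕ, (Fin n → Space d))) ⁻¹' _)
      rwa [preimage_image_eq _ hinj]
    · have h0 : (fun y => (⟨m, y⟩ : Σ n : ℕ, (Fin n → Space d))) ⁻¹'
          ((fun x => ⟨n, x⟩) '' s) = ∅ := by
        ext y
        simp only [mem_preimage, mem_empty_iff_false, iff_false]
        rintro ⟨x, -, h⟩
        exact hmn (congrArg Sigma.fst h)
      change MeasurableSet ((fun y => (⟨m, y⟩ : Σ n : ℕ, (Fin n → Space d))) ⁻¹' _)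
      rw [h0]
      exact MeasurableSet.empty
  have : f ⁻¹' s = ⋃ n, Prod.map id (fun x => (⟨n, x⟩ : Σ n : ℕ, (Fin n → Space d))) ''
      ((fun q : P × (Fin n → Space d) => f (q.1, ⟨n, q.2⟩)) ⁻¹' s) := by
    ext ⟨p, n, x⟩
    simp only [mem_preimage, mem_iUnion, mem_image, Prod.exists, Prod.map_apply, id_eq,
      Prod.mk.injEq]
    constructor
    · intro h
      exact ⟨n, p, x, h, rfl, rfl⟩
    · rintro ⟨m, p', x', h, rfl, h2⟩
      rwa [h2] at h
  rw [this]
  exact MeasurableSet.iUnion fun n =>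
    (MeasurableEmbedding.id.prodMap (hemb n)).measurableSet_image.2 (h n hs)

/-- The integral is lifted to ordered tuples: there measurability in parameter and point together is
checked for each n, and the measurability half of Fubini's theorem for s-finite measures applies.
This avoids the product σ-field of the parameter space with the configurations. -/
theorem JointlyMeasurable.integral {u : P → Config d → ℝ} (hu : JointlyMeasurable u) :
    Measurable fun p => ∫ ξ, u p ξ ∂(lebesguePoisson d) := by
  have h : ∀ p, ∫ ξ, u p ξ ∂(lebesguePoisson d) = ∫ ω, u p (ofTuple ω.1 ω.2) ∂(tupleMeasure d) := by
    intro p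
    rw [lebesguePoisson_eq_map, integral_map measurable_sigma_ofTuple.aemeasurable
      (hu.measurable p).aestronglyMeasurable]
  simp only [h]
  have : Measurable fun q : P × (Σ n : ℕ, (Fin n → Space d)) => u q.1 (ofTuple q.2.1 q.2.2) :=
    measurable_prod_sigma hu
  exact this.stronglyMeasurable.integral_prod_right.measurable

end

/-! ### Transfer of null sets between tuples and configurations -/

section

variable {d : ℕ} {P : Type*} [MeasurableSpace P] {ι κ : Type*} [Fintype ι] [Fintype κ]

/-- Up to relabelling this is the projection of a product onto one factor. The image measure need
not be Lebesgue measure, the forgotten factor having infinite mass in general, but null sets pull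
back to null sets. -/
theorem quasiMeasurePreserving_comp_injective {σ : κ → ι} (hσ : Function.Injective σ) :
    Measure.QuasiMeasurePreserving (fun x : ι → Space d => x ∘ σ) volume volume := by
  classical
  let : Fintype {i // i ∈ range σ} := Subtype.fintype _
  let e : κ ≃ {i // i ∈ range σ} := Equiv.ofInjective σ hσ
  have h1 := (volume_preserving_piEquivPiSubtypeProd (fun _ : ι => Space d)
    (fun i => i ∈ range σ)).quasiMeasurePreserving
  have h2 := (volume_measurePreserving_piCongrLeft
    (fun _ : {i // i ∈ range σ} => Space d) e).symm.quasiMeasurePreserving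
  have h3 : Measure.QuasiMeasurePreserving Prod.fst
      (volume : Measure (({i // i ∈ range σ} → Space d) × ({i // i ∉ range σ} → Space d)))
      volume := Measure.quasiMeasurePreserving_fst
  exact h2.comp (h3.comp h1)

theorem ae_ne_prod [NeZero d] : ∀ᵐ p : Space d × Space d, p.1 ≠ p.2 := by
  have hm : MeasurableSet {p : Space d × Space d | p.1 = p.2} :=
    measurableSet_eq_fun measurable_fst measurable_snd
  change volume {p : Space d × Space d | ¬ p.1 ≠ p.2} = 0
  simp only [ne_eq, not_not]
  rw [Measure.volume_eq_prod, Measure.measure_prod_null hm]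
  refine Eventually.of_forall fun x => ?_
  have : Prod.mk x ⁻¹' {p : Space d × Space d | p.1 = p.2} = {x} := by
    ext y
    simp [eq_comm]
  simp [this]

theorem ae_injective [NeZero d] : ∀ᵐ x : ι → Space d, Function.Injective x := by
  have h : ∀ i j : ι, i ≠ j → ∀ᵐ x : ι → Space d, x i ≠ x j := by
    intro i j hij
    have hσ : Function.Injective ![i, j] := by
      intro a b
      fin_cases a <;> fin_cases b <;> simp [hij, hij.symm]
    have h1 := (volume_preserving_finTwoArrow (Space d)).quasiMeasurePreserving.ae ae_ne_prod
    exact (quasiMeasurePreserving_comp_injective hσ).ae h1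
  have h' : ∀ᵐ x : ι → Space d, ∀ i j, i ≠ j → x i ≠ x j := by
    simp only [eventually_countable_forall]
    exact h
  filter_upwards [h'] with x h i j hij
  by_contra hne
  exact h i j hne hij

theorem ae_ofTuple {Q : Config d → Prop} (h : ∀ᵐ η ∂(lebesguePoisson d), Q η) (n : ℕ) :
    ∀ᵐ x : Fin n → Space d, Q (ofTuple n x) := by
  have h1 := (Measure.ae_sum_iff.1 h) n
  rw [Measure.ae_ennreal_smul_measure_iff (by simp)] at h1
  exact ae_of_ae_map (measurable_ofTuple n).aemeasurable h1

theorem ae_cfg {Q : Config d → Prop} (h : ∀ᵐ η ∂(lebesguePoisson d), Q η) :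
    ∀ᵐ x : ι → Space d, Q (cfg x) := by
  have h1 := (quasiMeasurePreserving_comp_injective (d := d)
    (Fintype.equivFin ι).symm.injective).ae (ae_ofTuple h (Fintype.card ι))
  filter_upwards [h1] with x hx
  rwa [← cfg_comp_equiv (Fintype.equivFin ι).symm x]

theorem ofTuple_eq_iff {n : ℕ} {x y : Fin n → Space d} (hy : Function.Injective y) :
    ofTuple n x = ofTuple n y ↔ ∃ σ : Equiv.Perm (Fin n), y = x ∘ σ := by
  constructor
  · intro h
    have hr : ∀ i, ∃ j, x j = y i := by
      intro i
      have : y i ∈ (ofTuple n x).points := by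
        rw [h]
        exact Finset.mem_image_of_mem _ (Finset.mem_univ _)
      simpa [ofTuple] using this
    choose σ hσ using hr
    have hinj : Function.Injective σ := fun i j hij => hy (by rw [← hσ, ← hσ, hij])
    exact ⟨Equiv.ofBijective σ (Finite.injective_iff_bijective.1 hinj), funext fun i => (hσ i).symm⟩
  · rintro ⟨σ, rfl⟩
    exact (cfg_comp_equiv σ x).symm

/-- The exceptional sets of tuples need not be measurable, while the λ-null set has to be covered by
a measurable set of configurations; a permutation-invariant measurable hull of each of them descends
to such a set. -/
theorem ae_lebesguePoisson_of_tuple [NeZero d] {Q : Config d → Prop}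
    (h : ∀ n, ∀ᵐ x : Fin n → Space d, Function.Injective x → Q (ofTuple n x)) :
    ∀ᵐ η ∂(lebesguePoisson d), Q η := by
  let A : ∀ n, Set (Fin n → Space d) := fun n => {x | ¬ (Function.Injective x → Q (ofTuple n x))}
  have hA : ∀ n, volume (A n) = 0 := h
  -- Intersecting the permuted copies of a measurable hull makes it symmetric without enlarging it.
  -- It keeps the injective points of `A n`, because their failure of Q does not depend on the
  -- order.
  let M : ∀ n, Set (Fin n → Space d) := fun n => ⋂ σ : Equiv.Perm (Fin n),
    (fun x => x ∘ σ) ⁻¹' toMeasurable volume (A n)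
  have hM : ∀ n, MeasurableSet (M n) := fun n => MeasurableSet.iInter fun σ =>
    (quasiMeasurePreserving_comp_injective σ.injective).measurable (measurableSet_toMeasurable _ _)
  have hM0 : ∀ n, volume (M n) = 0 := by
    intro n
    refine measure_mono_null (iInter_subset _ 1) ?_
    exact (measure_toMeasurable (A n)).trans (hA n)
  let N : Set (Config d) := {η | ∃ n, ∃ x : Fin n → Space d, Function.Injective x ∧
    ofTuple n x = η ∧ x ∈ M n}
  have hNM : ∀ n (x : Fin n → Space d), Function.Injective x → (ofTuple n x ∈ N ↔ x ∈ M n) := by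
    intro n x hx
    constructor
    · rintro ⟨m, y, hy, hyx, hyM⟩
      have hmn : m = n := by
        have := congrArg Config.card hyx
        rw [show ofTuple m y = cfg y from rfl, show ofTuple n x = cfg x from rfl, card_cfg hy,
          card_cfg hx] at this
        simpa using this
      subst hmn
      obtain ⟨τ, rfl⟩ := (ofTuple_eq_iff hx).1 hyx
      simp only [M, mem_iInter, mem_preimage] at hyM ⊢
      exact fun σ => hyM (τ * σ)
    · exact fun h => ⟨n, x, hx, rfl, h⟩
  have hN : MeasurableSet N := by
    refine measurableSet_config fun n => ?_
    have := measurableSet_tuple_of_injective (P := Unit) (A := {q | q.2 ∈ N})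
      (fun m => ⟨{q | q.2 ∈ M m}, measurable_snd (hM m), fun _ x hx => hNM m x hx⟩) n
    exact (measurable_prodMk_left (x := ())) this
  have hN0 : lebesguePoisson d N = 0 := by
    rw [lebesguePoisson, Measure.sum_apply _ hN]
    refine ENNReal.tsum_eq_zero.2 fun n => ?_
    rw [Measure.smul_apply, Measure.map_apply (measurable_ofTuple n) hN]
    have : volume (ofTuple n ⁻¹' N) = 0 := by
      refine measure_mono_null (t := M n ∪ {x | ¬ Function.Injective x}) ?_
        (measure_union_null (hM0 n) ae_injective)
      intro x hx
      by_cases hi : Function.Injective x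
      · exact Or.inl ((hNM n x hi).1 hx)
      · exact Or.inr hi
    simp [this]
  refine measure_mono_null ?_ hN0
  intro η hη
  obtain ⟨n, x, hx, rfl⟩ : ∃ n, ∃ x : Fin n → Space d, Function.Injective x ∧ ofTuple n x = η :=
    ⟨_, exists_injective_ofTuple η⟩
  refine (hNM _ x hx).2 (mem_iInter.2 fun σ => subset_toMeasurable _ _ ?_)
  intro hc
  have h2 := hc (hx.comp σ.injective)
  rw [show ofTuple _ (x ∘ σ) = ofTuple _ x from cfg_comp_equiv σ x] at h2
  exact hη h2

theorem card_ofTuple {n : ℕ} {x : Fin n → Space d} (hx : Function.Injective x) :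
    (ofTuple n x).card = n :=
  (card_cfg hx).trans (Fintype.card_fin n)

open Classical in
theorem cfg_sum_elim (x : ι → Space d) (u : κ → Space d) :
    cfg (Sum.elim x u) = ⟨(cfg x).points ∪ (cfg u).points⟩ := by
  ext a
  simp [cfg]

open Classical in
theorem cfg_ne_eq_sdiff {x : ι → Space d} (hx : Function.Injective x) (i : ι)
    [Fintype {j // j ≠ i}] :
    cfg (fun j : {j // j ≠ i} => x j) = ⟨(cfg x).points \ {x i}⟩ := by
  ext a
  simp only [cfg, Finset.mem_image, Finset.mem_univ, true_and, Subtype.exists, Finset.mem_sdiff,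
    Finset.mem_singleton]
  constructor
  · rintro ⟨j, hj, rfl⟩
    exact ⟨⟨j, rfl⟩, fun h => hj (hx h)⟩
  · rintro ⟨⟨j, rfl⟩, h⟩
    exact ⟨j, fun hj => h (by rw [hj]), rfl⟩

open Classical in
theorem ae_sdiff [NeZero d] {Q : Config d → Prop} (h : ∀ᵐ η ∂(lebesguePoisson d), Q η) :
    ∀ᵐ η ∂(lebesguePoisson d), ∀ z ∈ η.points, Q ⟨η.points \ {z}⟩ := by
  refine ae_lebesguePoisson_of_tuple fun n => ?_
  have h1 : ∀ᵐ x : Fin n → Space d, ∀ i, Q (cfg (x ∘ (Subtype.val : {j // j ≠ i} → Fin n))) :=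
    ae_all_iff.2 fun i => (quasiMeasurePreserving_comp_injective Subtype.val_injective).ae
      (ae_cfg h)
  filter_upwards [h1] with x hx hinj z hz
  obtain ⟨i, -, rfl⟩ := Finset.mem_image.1 hz
  have := cfg_ne_eq_sdiff hinj i
  exact this ▸ hx i

open Classical in
theorem ae_union_cfg [NeZero d] {Q : Config d → Prop} (h : ∀ᵐ η ∂(lebesguePoisson d), Q η) :
    ∀ᵐ η ∂(lebesguePoisson d), ∀ᵐ u : κ → Space d, Q ⟨η.points ∪ (cfg u).points⟩ := by
  refine ae_lebesguePoisson_of_tuple fun n => ?_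
  have h1 := (volume_measurePreserving_sumPiEquivProdPi_symm
    (fun _ : Fin n ⊕ κ => Space d)).quasiMeasurePreserving.ae (ae_cfg (ι := Fin n ⊕ κ) h)
  filter_upwards [Measure.ae_ae_of_ae_prod h1] with x hx _
  filter_upwards [hx] with u hu
  have := cfg_sum_elim x u
  convert hu using 1
  exact this.symm

open Classical in
theorem ae_union [NeZero d] {Q : Config d → Prop} (h : ∀ᵐ η ∂(lebesguePoisson d), Q η) :
    ∀ᵐ η ∂(lebesguePoisson d), ∀ᵐ ξ ∂(lebesguePoisson d), Q ⟨η.points ∪ ξ.points⟩ := by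
  have h1 : ∀ᵐ η ∂(lebesguePoisson d), ∀ n, ∀ᵐ u : Fin n → Space d,
      Q ⟨η.points ∪ (cfg u).points⟩ := ae_all_iff.2 fun n => ae_union_cfg h
  filter_upwards [h1] with η hη
  refine ae_lebesguePoisson_of_tuple fun n => ?_
  filter_upwards [hη n] with u hu _ using hu

open Classical in
theorem ae_union_singleton [NeZero d] {Q : Config d → Prop}
    (h : ∀ᵐ η ∂(lebesguePoisson d), Q η) :
    ∀ᵐ η ∂(lebesguePoisson d), ∀ᵐ y : Space d, Q ⟨η.points ∪ {y}⟩ := by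
  filter_upwards [ae_union_cfg (κ := Fin 1) h] with η hη
  have h1 := (volume_preserving_funUnique (Fin 1) (Space d)).symm.quasiMeasurePreserving.ae hη
  filter_upwards [h1] with y hy
  convert hy using 4
  ext a
  simp [cfg, eq_comm]

open Classical in
theorem ae_union_pair [NeZero d] {Q : Config d → Prop}
    (h : ∀ᵐ η ∂(lebesguePoisson d), Q η) :
    ∀ᵐ η ∂(lebesguePoisson d), ∀ᵐ p : Space d × Space d, Q ⟨η.points ∪ {p.1, p.2}⟩ := by
  filter_upwards [ae_union_cfg (κ := Fin 2) h] with η hη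
  have h1 := (volume_preserving_finTwoArrow (Space d)).symm.quasiMeasurePreserving.ae hη
  filter_upwards [h1] with p hp
  convert hp using 4
  ext a
  simp [cfg, Fin.exists_fin_two, eq_comm]

end

/-! ### The operators: independence of the representative and measurability -/

section

variable {d : ℕ} {P : Type*} [MeasurableSpace P] {ι κ : Type*} [Fintype ι] [Fintype κ]
  {c₁ : Space d → Space d → Space d → ℝ} {c₂ φ : Space d → ℝ}

/-- The part of `L^Δ` that remains when the multiplication operator `L₁₄ = -Ψ` is removed. -/
def offDiagonal (c₁ : Space d → Space d → Space d → ℝ) (c₂ φ : Space d → ℝ) (k : Config d → ℝ)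
    (η : Config d) : ℝ :=
  L₁₁ c₁ k η + L₁₂ c₁ k η + L₁₃ c₁ k η + L₂₁ c₂ φ k η + L₂₂ c₂ φ k η

theorem LΔ_eq (k : Config d → ℝ) (η : Config d) :
    LΔ c₁ c₂ φ k η = -(Ψ c₁ η * k η) + offDiagonal c₁ c₂ φ k η := by
  simp only [LΔ, offDiagonal, L₁₄]
  ring

section Congr

variable [NeZero d] {f g : Config d → ℝ}

theorem L₁₁_congr (h : f =ᵐ[lebesguePoisson d] g) : L₁₁ c₁ f =ᵐ[lebesguePoisson d] L₁₁ c₁ g := by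
  filter_upwards [ae_sdiff (ae_union_pair h)] with η hη
  unfold L₁₁
  congr 1
  refine integral_congr_ae ?_
  have : ∀ᵐ p : Space d × Space d, ∀ z ∈ η.points,
      f ⟨(η.points \ {z}) ∪ {p.1, p.2}⟩ = g ⟨(η.points \ {z}) ∪ {p.1, p.2}⟩ :=
    (η.points.eventually_all).2 hη
  filter_upwards [this] with p hp
  exact Finset.sum_congr rfl fun z hz => by rw [hp z hz]

theorem L₁₂_congr (h : f =ᵐ[lebesguePoisson d] g) : L₁₂ c₁ f =ᵐ[lebesguePoisson d] L₁₂ c₁ g := by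
  filter_upwards [ae_union_singleton h] with η hη
  unfold L₁₂
  congr 2
  refine integral_congr_ae ?_
  filter_upwards [Measure.quasiMeasurePreserving_fst.ae hη] with p hp
  exact Finset.sum_congr rfl fun z hz => by rw [hp]

theorem L₁₃_congr (h : f =ᵐ[lebesguePoisson d] g) : L₁₃ c₁ f =ᵐ[lebesguePoisson d] L₁₃ c₁ g := by
  filter_upwards [ae_union_singleton h] with η hη
  unfold L₁₃
  congr 2
  refine integral_congr_ae ?_
  filter_upwards [Measure.quasiMeasurePreserving_fst.ae hη] with p hp
  exact Finset.sum_congr rfl fun z hz => by rw [hp]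

/-- The exceptional set of η must not depend on y, since y is later integrated over or taken to be a
point of the configuration. -/
theorem ae_Q_congr (h : f =ᵐ[lebesguePoisson d] g) :
    ∀ᵐ η ∂(lebesguePoisson d), ∀ y, Q φ y f η = Q φ y g η := by
  filter_upwards [ae_union h] with η hη y
  refine integral_congr_ae ?_
  filter_upwards [hη] with ξ hξ
  rw [hξ]

theorem L₂₁_congr (h : f =ᵐ[lebesguePoisson d] g) :
    L₂₁ c₂ φ f =ᵐ[lebesguePoisson d] L₂₁ c₂ φ g := by
  filter_upwards [ae_sdiff (ae_union_singleton (ae_Q_congr (φ := φ) h))] with η hη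
  refine integral_congr_ae ?_
  filter_upwards [(η.points.eventually_all).2 hη] with x hx
  exact Finset.sum_congr rfl fun z hz => by rw [hx z hz z]

theorem L₂₂_congr (h : f =ᵐ[lebesguePoisson d] g) :
    L₂₂ c₂ φ f =ᵐ[lebesguePoisson d] L₂₂ c₂ φ g := by
  filter_upwards [ae_Q_congr (φ := φ) h] with η hη
  simp only [L₂₂, hη]

theorem offDiagonal_congr (h : f =ᵐ[lebesguePoisson d] g) :
    offDiagonal c₁ c₂ φ f =ᵐ[lebesguePoisson d] offDiagonal c₁ c₂ φ g := by
  filter_upwards [L₁₁_congr (c₁ := c₁) h, L₁₂_congr (c₁ := c₁) h, L₁₃_congr (c₁ := c₁) h,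
    L₂₁_congr (c₂ := c₂) (φ := φ) h, L₂₂_congr (c₂ := c₂) (φ := φ) h] with η h1 h2 h3 h4 h5
  simp only [offDiagonal, h1, h2, h3, h4, h5]

theorem LΔ_congr (h : f =ᵐ[lebesguePoisson d] g) :
    LΔ c₁ c₂ φ f =ᵐ[lebesguePoisson d] LΔ c₁ c₂ φ g := by
  filter_upwards [h, offDiagonal_congr (c₁ := c₁) (c₂ := c₂) (φ := φ) h] with η h1 h2
  rw [LΔ_eq, LΔ_eq, h1, h2]

end Congr

section Measurability

theorem measurable_sum_elim {ι κ R : Type*} [MeasurableSpace R] {a : R → ι → Space d}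
    {b : R → κ → Space d} (ha : Measurable a) (hb : Measurable b) :
    Measurable fun r => Sum.elim (a r) (b r) := by
  refine measurable_pi_lambda _ fun i => ?_
  cases i with
  | inl i => exact (measurable_pi_apply i).comp ha
  | inr i => exact (measurable_pi_apply i).comp hb

theorem measurable_pair {R : Type*} [MeasurableSpace R] {a b : R → Space d} (ha : Measurable a)
    (hb : Measurable b) : Measurable fun r => ![a r, b r] := by
  refine measurable_pi_lambda _ fun i => ?_
  fin_cases i
  · exact ha
  · exact hb

open Classical in
theorem points_cfg_pair (x y : Space d) : (cfg ![x, y]).points = {x, y} := by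
  ext a
  simp [cfg, Fin.exists_fin_two, eq_comm]

open Classical in
theorem points_cfg_const (x : Space d) : (cfg fun _ : Fin 1 => x).points = {x} := by
  ext a
  simp [cfg, eq_comm]

open Classical in
theorem sum_ofTuple {n : ℕ} {x : Fin n → Space d} (hx : Function.Injective x) (f : Space d → ℝ) :
    ∑ z ∈ (ofTuple n x).points, f z = ∑ i, f (x i) :=
  Finset.sum_image hx.injOn

open Classical in
theorem prod_ofTuple {n : ℕ} {x : Fin n → Space d} (hx : Function.Injective x)
    (f : Space d → ℝ) : ∏ z ∈ (ofTuple n x).points, f z = ∏ i, f (x i) :=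
  Finset.prod_image hx.injOn

open Classical in
theorem prod_sdiff_ofTuple {n : ℕ} {x : Fin n → Space d} (hx : Function.Injective x) (i : Fin n)
    (f : Space d → ℝ) : ∏ z ∈ (ofTuple n x).points \ {x i}, f z = ∏ j : {j // j ≠ i}, f (x j) := by
  have h := congrArg Config.points (cfg_ne_eq_sdiff hx i)
  change _ = (ofTuple n x).points \ {x i} at h
  rw [← h]
  exact Finset.prod_image (hx.comp Subtype.val_injective).injOn

open Classical in
theorem sdiff_union_ofTuple {n : ℕ} {x : Fin n → Space d} (hx : Function.Injective x) (i : Fin n)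
    (u : κ → Space d) : (⟨((ofTuple n x).points \ {x i}) ∪ (cfg u).points⟩ : Config d) =
      cfg (Sum.elim (fun j : {j // j ≠ i} => x j) u) := by
  rw [cfg_sum_elim, cfg_ne_eq_sdiff hx i]
  rfl

open Classical in
theorem measurable_union_cfg {R : Type*} [MeasurableSpace R] {b : R → κ → Space d}
    (hb : Measurable b) (A : Finset (Space d)) :
    Measurable fun r => (⟨A ∪ (cfg (b r)).points⟩ : Config d) := by
  obtain ⟨x, -, hx⟩ := exists_injective_ofTuple (⟨A⟩ : Config d)
  have h : (fun r => (⟨A ∪ (cfg (b r)).points⟩ : Config d)) =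
      fun r => cfg (Sum.elim x (b r)) := by
    ext1 r
    rw [cfg_sum_elim, show cfg x = ⟨A⟩ from hx]
  rw [h]
  exact measurable_cfg.comp (measurable_sum_elim measurable_const hb)

open Classical in
theorem measurable_union_singleton (A : Finset (Space d)) :
    Measurable fun x => (⟨A ∪ {x}⟩ : Config d) := by
  have h := measurable_union_cfg (b := fun (x : Space d) (_ : Fin 1) => x)
    (measurable_pi_lambda _ fun _ => measurable_id) A
  simpa only [points_cfg_const] using h

open Classical in
theorem measurable_union_pair (A : Finset (Space d)) :
    Measurable fun p : Space d × Space d => (⟨A ∪ {p.1, p.2}⟩ : Config d) := by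
  have h := measurable_union_cfg (measurable_pair (d := d) measurable_fst measurable_snd) A
  simpa only [points_cfg_pair] using h

open Classical in
theorem measurable_union (A : Finset (Space d)) :
    Measurable fun ξ : Config d => (⟨A ∪ ξ.points⟩ : Config d) :=
  measurable_config fun _ => measurable_union_cfg measurable_id A

variable {u : P → Config d → ℝ}

theorem JointlyMeasurable.prod {f : P → Space d → ℝ}
    (hf : Measurable fun q : P × Space d => f q.1 q.2) :
    JointlyMeasurable fun p (η : Config d) => ∏ z ∈ η.points, f p z := by
  refine JointlyMeasurable.of_injective fun n => ⟨fun q => ∏ i, f q.1 (q.2 i), ?_, ?_⟩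
  · exact Finset.measurable_prod _ fun i _ =>
      hf.comp (measurable_fst.prodMk ((measurable_pi_apply i).comp measurable_snd))
  · exact fun p x hx => prod_ofTuple hx _

theorem measurable_integral_of_uncurry {R Y : Type*} [MeasurableSpace R] [MeasureSpace Y]
    [SFinite (volume : Measure Y)] {f : R → Y → ℝ} (hf : Measurable fun q : R × Y => f q.1 q.2) :
    Measurable fun r => ∫ y, f r y :=
  hf.stronglyMeasurable.integral_prod_right.measurable

/-- The point y belongs to the parameter because L₂₁ evaluates Q at a point of η and L₂₂ integrates
over y. -/
theorem JointlyMeasurable.Q (hφ : Measurable φ) (hu : JointlyMeasurable u) :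
    JointlyMeasurable fun (q : P × Space d) η => Q φ q.2 (u q.1) η := by
  intro n
  refine JointlyMeasurable.integral (P := (P × Space d) × (Fin n → Space d))
    (u := fun r ξ => u r.1.1 _ * ∏ z ∈ ξ.points, (Real.exp (-φ (r.1.2 - z)) - 1))
    (JointlyMeasurable.mul (fun m => ?_) (JointlyMeasurable.prod ?_))
  · have h := hu.comp_cfg (R := ((P × Space d) × (Fin n → Space d)) × (Fin m → Space d))
      (a := fun r => r.1.1.1) (b := fun r => Sum.elim r.1.2 r.2) (by fun_prop)
      (measurable_sum_elim (by fun_prop) (by fun_prop))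
    simp only [cfg_sum_elim] at h
    exact h
  · fun_prop

variable (hm : ModelAssumptions c₁ c₂ φ)
include hm

theorem L₁₃_eq_L₁₂ (k : Config d → ℝ) : L₁₃ c₁ k = L₁₂ c₁ k := by
  ext η
  simp only [L₁₃, L₁₂]
  congr! 6 with q x
  exact hm.c₁_symm _ _ _

theorem JointlyMeasurable.L₁₁ (hu : JointlyMeasurable u) :
    JointlyMeasurable fun p => L₁₁ c₁ (u p) := by
  classical
  refine JointlyMeasurable.of_injective fun n => ⟨fun q => (1 / 2 : ℝ) *
    ∫ p : Space d × Space d, ∑ i, c₁ p.1 p.2 (q.2 i) *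
      u q.1 (cfg (Sum.elim (fun j : {j // j ≠ i} => q.2 j) ![p.1, p.2])), ?_, ?_⟩
  · refine Measurable.const_mul (measurable_integral_of_uncurry ?_) _
    refine Finset.measurable_sum _ fun i _ => Measurable.mul ?_ ?_
    · exact hm.measurable_c₁.comp (f := fun r : (P × (Fin n → Space d)) × (Space d × Space d) =>
        (r.2.1, r.2.2, r.1.2 i)) (by fun_prop)
    · exact hu.comp_cfg (by fun_prop)
        (measurable_sum_elim (by fun_prop) (measurable_pair (by fun_prop) (by fun_prop)))
  · intro p x hx
    simp only [JumpCoalescence.L₁₁, sum_ofTuple hx, ← sdiff_union_ofTuple hx, points_cfg_pair]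

theorem JointlyMeasurable.L₁₂ (hu : JointlyMeasurable u) :
    JointlyMeasurable fun p => L₁₂ c₁ (u p) := by
  classical
  refine JointlyMeasurable.of_injective fun n => ⟨fun q => -((1 / 2 : ℝ) *
    ∫ p : Space d × Space d, ∑ i, c₁ (q.2 i) p.1 p.2 *
      u q.1 (cfg (Sum.elim q.2 (fun _ : Fin 1 => p.1)))), ?_, ?_⟩
  · refine (Measurable.const_mul (measurable_integral_of_uncurry ?_) _).neg
    refine Finset.measurable_sum _ fun i _ => Measurable.mul ?_ ?_
    · exact hm.measurable_c₁.comp (f := fun r : (P × (Fin n → Space d)) × (Space d × Space d) =>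
        (r.1.2 i, r.2.1, r.2.2)) (by fun_prop)
    · exact hu.comp_cfg (by fun_prop) (measurable_sum_elim (by fun_prop) (by fun_prop))
  · intro p x hx
    simp only [JumpCoalescence.L₁₂, sum_ofTuple hx, cfg_sum_elim, points_cfg_const]
    rfl

theorem JointlyMeasurable.L₁₃ (hu : JointlyMeasurable u) :
    JointlyMeasurable fun p => L₁₃ c₁ (u p) := by
  simp only [L₁₃_eq_L₁₂ hm]
  exact hu.L₁₂ hm

theorem JointlyMeasurable.L₂₁ (hu : JointlyMeasurable u) :
    JointlyMeasurable fun p => L₂₁ c₂ φ (u p) := by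
  classical
  have hφ := hm.measurable_φ
  have hc := hm.measurable_c₂
  refine JointlyMeasurable.of_injective fun n => ⟨fun q =>
    ∫ y : Space d, ∑ i, c₂ (y - q.2 i) *
      (∏ j : {j // j ≠ i}, Real.exp (-φ (q.2 i - q.2 j))) * JumpCoalescence.Q φ (q.2 i) (u q.1)
      (cfg (Sum.elim (fun j : {j // j ≠ i} => q.2 j) (fun _ : Fin 1 => y))), ?_, ?_⟩
  · refine measurable_integral_of_uncurry ?_
    refine Finset.measurable_sum _ fun i _ => Measurable.mul (Measurable.mul (by fun_prop) ?_) ?_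
    · exact Finset.measurable_prod _ fun j _ => by fun_prop
    · exact (hu.Q hφ).comp_cfg
        (a := fun r : (P × (Fin n → Space d)) × Space d => (r.1.1, r.1.2 i)) (by fun_prop)
        (measurable_sum_elim (by fun_prop) (by fun_prop))
  · intro p x hx
    simp only [JumpCoalescence.L₂₁, sum_ofTuple hx, ← sdiff_union_ofTuple hx, points_cfg_const,
      prod_sdiff_ofTuple hx]

theorem JointlyMeasurable.L₂₂ (hu : JointlyMeasurable u) :
    JointlyMeasurable fun p => L₂₂ c₂ φ (u p) := by
  classical
  have hφ := hm.measurable_φ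
  have hc := hm.measurable_c₂
  refine JointlyMeasurable.of_injective fun n => ⟨fun q =>
    -∫ y : Space d, ∑ i, c₂ (q.2 i - y) *
      (∏ j : {j // j ≠ i}, Real.exp (-φ (y - q.2 j))) *
        JumpCoalescence.Q φ y (u q.1) (cfg q.2), ?_, ?_⟩
  · refine (measurable_integral_of_uncurry ?_).neg
    refine Finset.measurable_sum _ fun i _ => Measurable.mul (Measurable.mul (by fun_prop) ?_) ?_
    · exact Finset.measurable_prod _ fun j _ => by fun_prop
    · exact (hu.Q hφ).comp_cfg
        (a := fun r : (P × (Fin n → Space d)) × Space d => (r.1.1, r.2)) (by fun_prop)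
        (by fun_prop)
  · intro p x hx
    simp only [JumpCoalescence.L₂₂, sum_ofTuple hx, prod_sdiff_ofTuple hx]
    rfl

theorem JointlyMeasurable.offDiagonal (hu : JointlyMeasurable u) :
    JointlyMeasurable fun p => offDiagonal c₁ c₂ φ (u p) :=
  fun n => (((((hu.L₁₁ hm) n).add ((hu.L₁₂ hm) n)).add ((hu.L₁₃ hm) n)).add
    ((hu.L₂₁ hm) n)).add ((hu.L₂₂ hm) n)

theorem measurable_Ψ : Measurable (Ψ (d := d) c₁) := by
  classical
  have h : JointlyMeasurable (d := d) fun (_ : Unit) => Ψ c₁ := by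
    refine JointlyMeasurable.of_injective fun n => ⟨fun q => ∫ z : Space d, (1 / 2 : ℝ) *
      ∑ i : Fin n × Fin n, if i.1 ≠ i.2 then c₁ (q.2 i.1) (q.2 i.2) z else 0, ?_, ?_⟩
    · refine measurable_integral_of_uncurry (Measurable.const_mul ?_ _)
      refine Finset.measurable_sum _ fun i _ => ?_
      split_ifs
      · exact hm.measurable_c₁.comp (f := fun r : (Unit × (Fin n → Space d)) × Space d =>
          (r.1.2 i.1, r.1.2 i.2, r.2)) (by fun_prop)
      · exact measurable_const
    · intro _ x hx
      simp only [Ψ]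
      refine integral_congr_ae (Eventually.of_forall fun z => ?_)
      simp only
      congr 1
      rw [← Finset.sum_filter]
      symm
      refine Finset.sum_bij (fun i _ => (x i.1, x i.2)) ?_ ?_ ?_ ?_
      · intro i hi
        simp only [Finset.mem_filter, Finset.mem_univ, true_and] at hi
        simp [ofTuple, hx.ne hi]
      · rintro ⟨i, j⟩ _ ⟨i', j'⟩ _ h
        simp only [Prod.mk.injEq] at h
        rw [hx h.1, hx h.2]
      · rintro ⟨a, b⟩ hab
        simp only [ofTuple, Finset.mem_offDiag, Finset.mem_image, Finset.mem_univ, true_and] at hab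
        obtain ⟨⟨i, rfl⟩, ⟨j, rfl⟩, hne⟩ := hab
        exact ⟨(i, j), by simpa using fun h => hne (by rw [h]), rfl⟩
      · intro i _
        rfl
  exact h.measurable ()

end Measurability

end

/-! ### The weighted estimate for the off-diagonal part -/

section

variable {d : ℕ} {c₁ : Space d → Space d → Space d → ℝ} {c₂ φ : Space d → ℝ}

/-- `k` is a measurable function with `|k(η)| ≤ C e^{θ|η|}` for every (not only almost every)
configuration `η`. -/
structure WeightBound (θ C : ℝ) (k : Config d → ℝ) : Prop where
  measurable : Measurable k
  le : ∀ η, |k η| ≤ C * Real.exp (θ * η.card)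

theorem WeightBound.nonneg {θ C : ℝ} {k : Config d → ℝ} (h : WeightBound θ C k) : 0 ≤ C := by
  have := (abs_nonneg _).trans (h.le ⟨∅⟩)
  exact nonneg_of_mul_nonneg_left this (Real.exp_pos _)

theorem WeightBound.mono {θ θ' C C' : ℝ} {k : Config d → ℝ} (h : WeightBound θ C k) (hθ : θ ≤ θ')
    (hC : C ≤ C') : WeightBound θ' C' k :=
  ⟨h.measurable, fun η => (h.le η).trans (by
    have := h.nonneg.trans hC
    gcongr)⟩

section KernelSum

variable {Y : Type*} [MeasureSpace Y] {s : Finset (Space d)} {w f g : Space d → Y → ℝ} {M : ℝ}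

theorem integrable_kernel_sum (hw : ∀ z ∈ s, Integrable (w z))
    (hf : ∀ z ∈ s, AEStronglyMeasurable (f z)) (hM : ∀ z ∈ s, ∀ᵐ p, |f z p| ≤ M) :
    Integrable fun p => ∑ z ∈ s, w z p * f z p := by
  refine integrable_finsetSum _ fun z hz => ?_
  have := (hw z hz).bdd_mul (hf z hz) (hM z hz)
  simpa only [mul_comm] using this

/-- Every term of the off-diagonal part is an integral of this shape: a non-negative kernel whose
mass J is the same for all z ∈ η, times a function bounded almost everywhere. The sum over η is the
source of the factor |η|. -/
theorem abs_integral_kernel_sum_le {J : ℝ} (hw : ∀ z ∈ s, Integrable (w z))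
    (hw0 : ∀ z p, 0 ≤ w z p) (hJ : ∀ z ∈ s, ∫ p, w z p = J)
    (hM : ∀ z ∈ s, ∀ᵐ p, |f z p| ≤ M) :
    |∫ p, ∑ z ∈ s, w z p * f z p| ≤ s.card * J * M := by
  have h1 : ∀ᵐ p, ‖∑ z ∈ s, w z p * f z p‖ ≤ ∑ z ∈ s, w z p * M := by
    filter_upwards [(s.eventually_all).2 hM] with p hp
    refine (norm_sum_le _ _).trans (Finset.sum_le_sum fun z hz => ?_)
    rw [Real.norm_eq_abs, abs_mul, abs_of_nonneg (hw0 z p)]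
    exact mul_le_mul_of_nonneg_left (hp z hz) (hw0 z p)
  have h2 := norm_integral_le_of_norm_le
    (integrable_finsetSum _ fun z hz => (hw z hz).mul_const M) h1
  rw [Real.norm_eq_abs] at h2
  refine h2.trans_eq ?_
  rw [integral_finsetSum _ fun z hz => (hw z hz).mul_const M]
  simp only [integral_mul_const]
  rw [Finset.sum_congr rfl fun z hz => by rw [hJ z hz]]
  simp [mul_assoc]

theorem integral_kernel_sum_sub {M' : ℝ} (hw : ∀ z ∈ s, Integrable (w z))
    (hf : ∀ z ∈ s, AEStronglyMeasurable (f z)) (hM : ∀ z ∈ s, ∀ᵐ p, |f z p| ≤ M)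
    (hg : ∀ z ∈ s, AEStronglyMeasurable (g z)) (hM' : ∀ z ∈ s, ∀ᵐ p, |g z p| ≤ M') :
    ∫ p, ∑ z ∈ s, w z p * (f z p - g z p) =
      (∫ p, ∑ z ∈ s, w z p * f z p) - ∫ p, ∑ z ∈ s, w z p * g z p := by
  rw [← integral_sub (integrable_kernel_sum hw hf hM) (integrable_kernel_sum hw hg hM')]
  simp only [mul_sub, Finset.sum_sub_distrib]

end KernelSum

section Card

variable [NeZero d]

open Classical in
-- An added point misses A almost surely. The exact count is needed, not an upper bound: θ may be
-- negative, and then e^{θ|·|} decreases in the number of points.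
theorem ae_card_union_singleton (A : Finset (Space d)) :
    ∀ᵐ x : Space d, (⟨A ∪ {x}⟩ : Config d).card = A.card + 1 := by
  filter_upwards [compl_mem_ae_iff.2 (A.measure_zero volume)] with x hx
  have hx : x ∉ A := by simpa using hx
  simp only [Config.card]
  rw [Finset.card_union_of_disjoint (by simpa using hx), Finset.card_singleton]

open Classical in
theorem ae_card_union_pair (A : Finset (Space d)) :
    ∀ᵐ p : Space d × Space d, (⟨A ∪ {p.1, p.2}⟩ : Config d).card = A.card + 2 := by
  have h : ∀ᵐ x : Space d, x ∉ A := by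
    filter_upwards [compl_mem_ae_iff.2 (A.measure_zero volume)] with x hx
    simpa using hx
  filter_upwards [Measure.quasiMeasurePreserving_fst.ae h,
    Measure.quasiMeasurePreserving_snd.ae h, ae_ne_prod] with p h1 h2 h3
  simp only [Config.card]
  rw [Finset.card_union_of_disjoint (by simp [h1, h2]), Finset.card_pair h3]

open Classical in
theorem ae_card_union (A : Finset (Space d)) :
    ∀ᵐ ξ ∂(lebesguePoisson d), (⟨A ∪ ξ.points⟩ : Config d).card = A.card + ξ.card := by
  refine ae_lebesguePoisson_of_tuple fun n => ?_
  have h : ∀ᵐ x : Fin n → Space d, ∀ i, ∀ z ∈ A, x i ≠ z := by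
    refine ae_all_iff.2 fun i => (A.eventually_all).2 fun z _ => ?_
    have := (Measure.quasiMeasurePreserving_eval (fun _ : Fin n => (volume : Measure (Space d))) i).ae
      (p := fun y => y ≠ z) (compl_mem_ae_iff.2 (measure_singleton z))
    exact this
  filter_upwards [h] with x hx _
  simp only [Config.card]
  refine Finset.card_union_of_disjoint (Finset.disjoint_left.2 fun z hz hzx => ?_)
  obtain ⟨i, -, rfl⟩ := Finset.mem_image.1 hzx
  exact hx i _ hz rfl

end Card

section Exponential

variable [NeZero d]

/-- On n-point configurations the integral factorises into (∫ f)ⁿ / n!, and the sum over n is the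
exponential series. -/
theorem lintegral_prod_points {f : Space d → ℝ} (hf : Measurable f) (hf0 : ∀ x, 0 ≤ f x)
    (hi : Integrable f) :
    ∫⁻ ξ, ENNReal.ofReal (∏ u ∈ ξ.points, f u) ∂(lebesguePoisson d) =
      ENNReal.ofReal (Real.exp (∫ x, f x)) := by
  have hm : Measurable fun ξ : Config d => ∏ u ∈ ξ.points, f u :=
    (JointlyMeasurable.prod (P := Unit) (f := fun _ => f) (by fun_prop)).measurable ()
  have hI : 0 ≤ ∫ x, f x := integral_nonneg hf0
  rw [lebesguePoisson, lintegral_sum_measure]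
  have h : ∀ n : ℕ, ∫⁻ ξ, ENNReal.ofReal (∏ u ∈ ξ.points, f u)
      ∂(((n.factorial : ℝ≥0∞)⁻¹) • (volume : Measure (Fin n → Space d)).map (ofTuple n)) =
      ENNReal.ofReal ((∫ x, f x) ^ n / n.factorial) := by
    intro n
    rw [lintegral_smul_measure, lintegral_map hm.ennreal_ofReal (measurable_ofTuple n)]
    have h1 : ∫⁻ x : Fin n → Space d, ENNReal.ofReal (∏ u ∈ (ofTuple n x).points, f u) =
        ∫⁻ x : Fin n → Space d, ENNReal.ofReal (∏ i, f (x i)) := by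
      refine lintegral_congr_ae ?_
      filter_upwards [ae_injective] with x hx
      rw [prod_ofTuple hx]
    have h2 : Integrable fun x : Fin n → Space d => ∏ i, f (x i) :=
      Integrable.fintype_prod fun _ => hi
    rw [h1, ← ofReal_integral_eq_lintegral_ofReal h2
      (Eventually.of_forall fun x => Finset.prod_nonneg fun i _ => hf0 _),
      integral_fintype_prod_volume_eq_pow, Fintype.card_fin, smul_eq_mul, div_eq_inv_mul,
      ENNReal.ofReal_mul (by positivity), ENNReal.ofReal_inv_of_pos (by positivity),
      ENNReal.ofReal_natCast]
  simp only [h]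
  rw [← ENNReal.ofReal_tsum_of_nonneg (fun n => by positivity)
    (Real.summable_pow_div_factorial _), Real.exp_eq_exp_ℝ, NormedSpace.exp_eq_tsum_div]

theorem integrable_prod_points {f : Space d → ℝ} (hf : Measurable f) (hf0 : ∀ x, 0 ≤ f x)
    (hi : Integrable f) :
    Integrable (fun ξ : Config d => ∏ u ∈ ξ.points, f u) (lebesguePoisson d) := by
  have hm : Measurable fun ξ : Config d => ∏ u ∈ ξ.points, f u :=
    (JointlyMeasurable.prod (P := Unit) (f := fun _ => f) (by fun_prop)).measurable ()
  refine ⟨hm.aestronglyMeasurable, ?_⟩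
  rw [hasFiniteIntegral_iff_ofReal (Eventually.of_forall fun ξ =>
    Finset.prod_nonneg fun i _ => hf0 _), lintegral_prod_points hf hf0 hi]
  exact ENNReal.ofReal_lt_top

theorem integral_prod_points {f : Space d → ℝ} (hf : Measurable f) (hf0 : ∀ x, 0 ≤ f x)
    (hi : Integrable f) :
    ∫ ξ, ∏ u ∈ ξ.points, f u ∂(lebesguePoisson d) = Real.exp (∫ x, f x) := by
  rw [integral_eq_lintegral_of_nonneg_ae (Eventually.of_forall fun ξ =>
    Finset.prod_nonneg fun i _ => hf0 _) (integrable_prod_points hf hf0 hi).1,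
    lintegral_prod_points hf hf0 hi, ENNReal.toReal_ofReal (Real.exp_pos _).le]

end Exponential

section Kernels

/-- Replacing one point by two almost surely raises the cardinality by one, whence the factor e^θ
beside ⟨c₁⟩ in β. -/
theorem L₁₁_kernel [NeZero d] {θ C : ℝ} {k : Config d → ℝ} (hk : WeightBound θ C k) (η : Config d) : open Classical in
    (∀ z ∈ η.points, AEStronglyMeasurable fun p : Space d × Space d =>
      k ⟨(η.points \ {z}) ∪ {p.1, p.2}⟩) ∧
    ∀ z ∈ η.points, ∀ᵐ p : Space d × Space d, |k ⟨(η.points \ {z}) ∪ {p.1, p.2}⟩| ≤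
      C * Real.exp (θ * (η.card + 1)) := by
  classical
  refine ⟨fun z _ => (hk.measurable.comp (measurable_union_pair _)).aestronglyMeasurable,
    fun z hz => ?_⟩
  filter_upwards [ae_card_union_pair (η.points \ {z})] with p hp
  have h := hk.le ⟨(η.points \ {z}) ∪ {p.1, p.2}⟩
  have h1 : (η.points \ {z}).card + 1 = η.card := by
    rw [Finset.sdiff_singleton_eq_erase]
    exact Finset.card_erase_add_one hz
  rwa [hp, show (((η.points \ {z}).card + 2 : ℕ) : ℝ) = η.card + 1 by
    rw [← h1]; push_cast; ring] at h

theorem L₁₂_kernel [NeZero d] {θ C : ℝ} {k : Config d → ℝ} (hk : WeightBound θ C k) (η : Config d) : open Classical in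
    (∀ z ∈ η.points, AEStronglyMeasurable fun p : Space d × Space d =>
      k ⟨η.points ∪ {p.1}⟩) ∧
    ∀ z ∈ η.points, ∀ᵐ p : Space d × Space d, |k ⟨η.points ∪ {p.1}⟩| ≤
      C * Real.exp (θ * (η.card + 1)) := by
  classical
  refine ⟨fun z _ => (hk.measurable.comp
    ((measurable_union_singleton _).comp measurable_fst)).aestronglyMeasurable, fun z hz => ?_⟩
  filter_upwards [Measure.quasiMeasurePreserving_fst.ae (ae_card_union_singleton η.points)]
    with p hp
  have h := hk.le ⟨η.points ∪ {p.1}⟩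
  rw [hp] at h
  exact_mod_cast h

theorem measurePreserving_sub_pair (z : Space d) :
    MeasurePreserving (fun p : Space d × Space d => (p.1 - z, p.2 - z)) :=
  (measurePreserving_sub_right volume z).prod (measurePreserving_sub_right volume z)

/-- The change of variables that translates the third argument of c₁ x p.1 p.2 to 0, so that its
integral over the last two variables is again ⟨c₁⟩. -/
theorem measurePreserving_sub_sub (x : Space d) :
    MeasurePreserving (fun p : Space d × Space d => (x - p.2, p.1 - p.2)) := by
  have h1 : MeasurePreserving (fun p : Space d × Space d => (p.2, p.1 - p.2)) :=
    measurePreserving_prod_sub_swap volume volume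
  exact ((Measure.measurePreserving_sub_left volume x).prod (MeasurePreserving.id volume)).comp h1

variable (hm : ModelAssumptions c₁ c₂ φ)
include hm

theorem c₁_shift (x y z : Space d) : c₁ (x - z) (y - z) 0 = c₁ x y z := by
  have := hm.c₁_translate (x - z) (y - z) 0 z
  simpa using this.symm

theorem integrable_c₁_left (z : Space d) :
    Integrable fun p : Space d × Space d => c₁ p.1 p.2 z := by
  have := (measurePreserving_sub_pair z).integrable_comp_of_integrable hm.c₁_integrable
  simpa only [Function.comp_def, c₁_shift hm] using this

theorem integral_c₁_left (z : Space d) :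
    ∫ p : Space d × Space d, c₁ p.1 p.2 z = c₁Integral c₁ := by
  have h1 := hm.measurable_c₁.comp (f := fun p : Space d × Space d => (p.1, p.2, 0)) (by fun_prop)
  have h2 := integral_map (measurePreserving_sub_pair z).measurable.aemeasurable
    (μ := volume) (f := fun p : Space d × Space d => c₁ p.1 p.2 0) h1.aestronglyMeasurable
  rw [(measurePreserving_sub_pair z).map_eq] at h2
  rw [c₁Integral, h2]
  simp only [c₁_shift hm]

theorem integrable_c₁_right (x : Space d) :
    Integrable fun p : Space d × Space d => c₁ x p.1 p.2 := by
  have := (measurePreserving_sub_sub x).integrable_comp_of_integrable hm.c₁_integrable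
  simpa only [Function.comp_def, c₁_shift hm] using this

theorem integral_c₁_right (x : Space d) :
    ∫ p : Space d × Space d, c₁ x p.1 p.2 = c₁Integral c₁ := by
  have h1 := hm.measurable_c₁.comp (f := fun p : Space d × Space d => (p.1, p.2, 0)) (by fun_prop)
  have h2 := integral_map (measurePreserving_sub_sub x).measurable.aemeasurable
    (μ := volume) (f := fun p : Space d × Space d => c₁ p.1 p.2 0) h1.aestronglyMeasurable
  rw [(measurePreserving_sub_sub x).map_eq] at h2
  rw [c₁Integral, h2]
  simp only [c₁_shift hm]

theorem c₁Integral_nonneg : 0 ≤ c₁Integral c₁ := integral_nonneg fun _ => hm.c₁_nonneg _ _ _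

theorem β_nonneg (θ : ℝ) : 0 ≤ β c₁ c₂ φ θ := by
  have h1 := c₁Integral_nonneg hm
  have h2 : 0 ≤ ∫ x, c₂ x := integral_nonneg hm.c₂_nonneg
  unfold β
  positivity

theorem β_mono {θ θ' : ℝ} (h : θ ≤ θ') : β c₁ c₂ φ θ ≤ β c₁ c₂ φ θ' := by
  have h1 := c₁Integral_nonneg hm
  have h2 : 0 ≤ ∫ x, c₂ x := integral_nonneg hm.c₂_nonneg
  have h3 : 0 ≤ ∫ x, φ x := integral_nonneg hm.φ_nonneg
  unfold β
  gcongr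

theorem Ψ_nonneg (η : Config d) : 0 ≤ Ψ c₁ η :=
  integral_nonneg fun _ => mul_nonneg (by norm_num) (Finset.sum_nonneg fun _ _ => hm.c₁_nonneg _ _ _)

/-- There are at most |η|² ordered pairs, and the supremum of ∫ c₁(x, y; z) dz bounds the
contribution of each. -/
theorem exists_Ψ_le : ∃ C, 0 ≤ C ∧ ∀ η : Config d, Ψ c₁ η ≤ C * (η.card : ℝ) ^ 2 := by
  classical
  set S : ℝ≥0∞ := ⨆ x, ⨆ y, ∫⁻ z, ENNReal.ofReal (c₁ x y z) with hS
  have hS' : S ≠ ∞ := hm.c₁_max.ne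
  have hle : ∀ x y, ∫⁻ z, ENNReal.ofReal (c₁ x y z) ≤ S := fun x y =>
    le_iSup₂ (f := fun x y => ∫⁻ z, ENNReal.ofReal (c₁ x y z)) x y
  have hmeas : ∀ x y, Measurable fun z => c₁ x y z := fun x y =>
    hm.measurable_c₁.comp (f := fun z => (x, y, z)) (by fun_prop)
  have hint : ∀ x y, Integrable fun z => c₁ x y z := by
    intro x y
    refine ⟨(hmeas x y).aestronglyMeasurable, ?_⟩
    rw [hasFiniteIntegral_iff_ofReal (Eventually.of_forall fun z => hm.c₁_nonneg x y z)]
    exact (hle x y).trans_lt hS'.lt_top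
  have hI : ∀ x y, ∫ z, c₁ x y z ≤ S.toReal := by
    intro x y
    rw [integral_eq_lintegral_of_nonneg_ae (Eventually.of_forall fun z => hm.c₁_nonneg x y z)
      (hmeas x y).aestronglyMeasurable]
    exact ENNReal.toReal_mono hS' (hle x y)
  refine ⟨S.toReal, ENNReal.toReal_nonneg, fun η => ?_⟩
  have h1 : Ψ c₁ η = (1 / 2 : ℝ) * ∑ p ∈ η.points.offDiag, ∫ z, c₁ p.1 p.2 z := by
    unfold Ψ
    rw [integral_const_mul, integral_finsetSum _ fun p _ => hint _ _]
  have h2 : ∑ p ∈ η.points.offDiag, ∫ z, c₁ p.1 p.2 z ≤ (η.card : ℝ) ^ 2 * S.toReal := by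
    refine (Finset.sum_le_card_nsmul _ _ _ fun p _ => hI _ _).trans ?_
    rw [nsmul_eq_mul]
    refine mul_le_mul_of_nonneg_right ?_ ENNReal.toReal_nonneg
    rw [Finset.offDiag_card, sq]
    exact_mod_cast Nat.sub_le _ _
  have h3 : 0 ≤ (η.card : ℝ) ^ 2 * S.toReal := by positivity
  rw [h1]
  linarith

theorem abs_exp_neg_sub_one_le (x : Space d) : |Real.exp (-φ x) - 1| ≤ φ x := by
  have h1 : Real.exp (-φ x) ≤ 1 := Real.exp_le_one_iff.2 (by linarith [hm.φ_nonneg x])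
  rw [abs_of_nonpos (by linarith)]
  linarith [Real.add_one_le_exp (-φ x)]

theorem measurable_Q {k : Config d → ℝ} (hk : Measurable k) :
    JointlyMeasurable fun (y : Space d) η => Q φ y k η :=
  ((JointlyMeasurable.of_measurable (P := Unit) hk).Q hm.measurable_φ).comp
    (a := fun y => ((), y)) (by fun_prop)

theorem measurable_offDiagonal {k : Config d → ℝ} (hk : Measurable k) :
    Measurable (offDiagonal c₁ c₂ φ k) :=
  ((JointlyMeasurable.of_measurable (P := Unit) hk).offDiagonal hm).measurable ()

variable [NeZero d] {θ C C' : ℝ} {k k' : Config d → ℝ}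

/-- The integrand of `Q_y k`, its integrability and its size. -/
theorem Q_integrable_and_le (hk : WeightBound θ C k) (y : Space d) (η : Config d) :
    (open Classical in Integrable (fun ξ : Config d => k ⟨η.points ∪ ξ.points⟩ *
      ∏ u ∈ ξ.points, (Real.exp (-φ (y - u)) - 1)) (lebesguePoisson d)) ∧
    |Q φ y k η| ≤ C * Real.exp (θ * η.card) * Real.exp ((∫ x, φ x) * Real.exp θ) := by
  classical
  have hφ := hm.measurable_φ
  -- Each point of ξ contributes |e^{-φ} - 1| ≤ φ and one factor e^θ from the bound on k(η ∪ ξ); the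
  -- exponential formula for this f then produces exp(⟨φ⟩ e^θ).
  set f : Space d → ℝ := fun u => φ (y - u) * Real.exp θ with hf
  have hf0 : ∀ u, 0 ≤ f u := fun u => mul_nonneg (hm.φ_nonneg _) (Real.exp_pos _).le
  have hfm : Measurable f := by fun_prop
  have hfi : Integrable f := (hm.φ_integrable.comp_sub_left y).mul_const _
  have hfI : ∫ u, f u = (∫ x, φ x) * Real.exp θ := by
    rw [hf, integral_mul_const, integral_sub_left_eq_self φ volume y]
  have hle : ∀ᵐ ξ ∂(lebesguePoisson d), ‖k ⟨η.points ∪ ξ.points⟩ *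
      ∏ u ∈ ξ.points, (Real.exp (-φ (y - u)) - 1)‖ ≤
      C * Real.exp (θ * η.card) * ∏ u ∈ ξ.points, f u := by
    filter_upwards [ae_card_union η.points] with ξ hξ
    have h1 := hk.le ⟨η.points ∪ ξ.points⟩
    rw [hξ] at h1
    have h2 : |∏ u ∈ ξ.points, (Real.exp (-φ (y - u)) - 1)| ≤ ∏ u ∈ ξ.points, φ (y - u) := by
      rw [Finset.abs_prod]
      exact Finset.prod_le_prod (fun _ _ => abs_nonneg _)
        fun u _ => abs_exp_neg_sub_one_le hm (y - u)
    rw [norm_mul, Real.norm_eq_abs, Real.norm_eq_abs]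
    calc _ ≤ (C * Real.exp (θ * ((η.points.card + ξ.card : ℕ) : ℝ))) *
          ∏ u ∈ ξ.points, φ (y - u) :=
          mul_le_mul h1 h2 (abs_nonneg _) (mul_nonneg hk.nonneg (Real.exp_pos _).le)
      _ = _ := by
          simp only [hf, Finset.prod_mul_distrib, Finset.prod_const, ← Real.exp_nat_mul]
          simp only [Config.card]
          rw [Nat.cast_add, mul_add, Real.exp_add, mul_comm θ (ξ.points.card : ℝ)]
          ring
  have hgi := (integrable_prod_points hfm hf0 hfi).const_mul (C * Real.exp (θ * η.card))
  have hmeas : Measurable fun ξ : Config d => k ⟨η.points ∪ ξ.points⟩ *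
      ∏ u ∈ ξ.points, (Real.exp (-φ (y - u)) - 1) :=
    (hk.measurable.comp (measurable_union η.points)).mul
      ((JointlyMeasurable.prod (P := Unit) (f := fun _ u => Real.exp (-φ (y - u)) - 1)
        (by fun_prop)).measurable ())
  refine ⟨hgi.mono' hmeas.aestronglyMeasurable hle, ?_⟩
  have h3 := norm_integral_le_of_norm_le hgi hle
  rw [integral_const_mul, integral_prod_points hfm hf0 hfi, hfI] at h3
  exact h3

theorem Q_sub (hk : WeightBound θ C k) (hk' : WeightBound θ C' k') (y : Space d) (η : Config d) :
    Q φ y (fun ζ => k ζ - k' ζ) η = Q φ y k η - Q φ y k' η := by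
  unfold Q
  rw [← integral_sub (Q_integrable_and_le hm hk y η).1 (Q_integrable_and_le hm hk' y η).1]
  simp only [sub_mul]

open Classical in
theorem abs_prod_exp_mul_Q_le (hk : WeightBound θ C k) (y : Space d) (η : Config d)
    (A : Finset (Space d)) :
    |(∏ u ∈ A, Real.exp (-φ (y - u))) * Q φ y k η| ≤
      C * Real.exp (θ * η.card) * Real.exp ((∫ x, φ x) * Real.exp θ) := by
  rw [abs_mul, Finset.abs_prod]
  refine (mul_le_of_le_one_left (abs_nonneg _) ?_).trans (Q_integrable_and_le hm hk y η).2
  refine Finset.prod_le_one (fun _ _ => abs_nonneg _) fun u _ => ?_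
  rw [Real.abs_exp]
  exact Real.exp_le_one_iff.2 (by linarith [hm.φ_nonneg (y - u)])

theorem L₂₁_kernel (hk : WeightBound θ C k) (η : Config d) : open Classical in
    (∀ z ∈ η.points, AEStronglyMeasurable fun x : Space d =>
      (∏ u ∈ η.points \ {z}, Real.exp (-φ (z - u))) * Q φ z k ⟨(η.points \ {z}) ∪ {x}⟩) ∧
    ∀ z ∈ η.points, ∀ᵐ x : Space d, |(∏ u ∈ η.points \ {z}, Real.exp (-φ (z - u))) *
      Q φ z k ⟨(η.points \ {z}) ∪ {x}⟩| ≤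
      C * Real.exp (θ * η.card) * Real.exp ((∫ x, φ x) * Real.exp θ) := by
  classical
  refine ⟨fun z _ => (measurable_const.mul (((measurable_Q hm hk.measurable).measurable z).comp
    (measurable_union_singleton _))).aestronglyMeasurable, fun z hz => ?_⟩
  filter_upwards [ae_card_union_singleton (η.points \ {z})] with x hx
  have h := abs_prod_exp_mul_Q_le hm hk z ⟨(η.points \ {z}) ∪ {x}⟩ (η.points \ {z})
  have h1 : (η.points \ {z}).card + 1 = η.card := by
    rw [Finset.sdiff_singleton_eq_erase]
    exact Finset.card_erase_add_one hz
  rwa [hx, h1] at h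

theorem L₂₂_kernel (hk : WeightBound θ C k) (η : Config d) : open Classical in
    (∀ z ∈ η.points, AEStronglyMeasurable fun y : Space d =>
      (∏ u ∈ η.points \ {z}, Real.exp (-φ (y - u))) * Q φ y k η) ∧
    ∀ z ∈ η.points, ∀ᵐ y : Space d, |(∏ u ∈ η.points \ {z}, Real.exp (-φ (y - u))) *
      Q φ y k η| ≤ C * Real.exp (θ * η.card) * Real.exp ((∫ x, φ x) * Real.exp θ) := by
  classical
  have hφ := hm.measurable_φ
  refine ⟨fun z _ => (Measurable.mul (Finset.measurable_prod _ fun u _ => by fun_prop)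
    ((measurable_Q hm hk.measurable).measurable_left η)).aestronglyMeasurable,
    fun z hz => Eventually.of_forall fun y => abs_prod_exp_mul_Q_le hm hk y η _⟩

/-- The weighted bound `‖B‖ ≤ β(θ) |η|` for the part `B` of `L^Δ` off the diagonal. -/
theorem abs_offDiagonal_le (hk : WeightBound θ C k) (η : Config d) :
    |offDiagonal c₁ c₂ φ k η| ≤ C * β c₁ c₂ φ θ * (η.card * Real.exp (θ * η.card)) := by
  classical
  have h1 : |L₁₁ c₁ k η| ≤
      1 / 2 * (η.card * c₁Integral c₁ * (C * Real.exp (θ * (η.card + 1)))) := by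
    rw [L₁₁, abs_mul, abs_of_pos (by norm_num)]
    exact mul_le_mul_of_nonneg_left (abs_integral_kernel_sum_le (w := fun (z : Space d) (p : Space d × Space d) => c₁ p.1 p.2 z)
      (fun z _ => integrable_c₁_left hm z) (fun _ _ => hm.c₁_nonneg _ _ _)
      (fun z _ => integral_c₁_left hm z) (L₁₁_kernel hk η).2) (by norm_num)
  have h2 : |L₁₂ c₁ k η| ≤
      1 / 2 * (η.card * c₁Integral c₁ * (C * Real.exp (θ * (η.card + 1)))) := by
    rw [L₁₂, abs_neg, abs_mul, abs_of_pos (by norm_num)]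
    exact mul_le_mul_of_nonneg_left (abs_integral_kernel_sum_le (w := fun (x : Space d) (p : Space d × Space d) => c₁ x p.1 p.2)
      (f := fun (_ : Space d) (p : Space d × Space d) => k ⟨η.points ∪ {p.1}⟩)
      (fun z _ => integrable_c₁_right hm z) (fun _ _ => hm.c₁_nonneg _ _ _)
      (fun z _ => integral_c₁_right hm z) (L₁₂_kernel hk η).2) (by norm_num)
  have h4 : |L₂₁ c₂ φ k η| ≤ η.card * (∫ x, c₂ x) *
      (C * Real.exp (θ * η.card) * Real.exp ((∫ x, φ x) * Real.exp θ)) := by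
    simp only [L₂₁, mul_assoc]
    have := abs_integral_kernel_sum_le (w := fun z x => c₂ (x - z))
      (fun z _ => hm.c₂_integrable.comp_sub_right z) (fun _ _ => hm.c₂_nonneg _)
      (fun z _ => integral_sub_right_eq_self c₂ z) (L₂₁_kernel hm hk η).2
    simpa only [mul_assoc, Config.card] using this
  have h5 : |L₂₂ c₂ φ k η| ≤ η.card * (∫ x, c₂ x) *
      (C * Real.exp (θ * η.card) * Real.exp ((∫ x, φ x) * Real.exp θ)) := by
    simp only [L₂₂, mul_assoc, abs_neg]
    have := abs_integral_kernel_sum_le (w := fun z y => c₂ (z - y))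
      (fun z _ => hm.c₂_integrable.comp_sub_left z) (fun _ _ => hm.c₂_nonneg _)
      (fun z _ => integral_sub_left_eq_self c₂ volume z) (L₂₂_kernel hm hk η).2
    simpa only [mul_assoc, Config.card] using this
  have h : |offDiagonal c₁ c₂ φ k η| ≤ |L₁₁ c₁ k η| + |L₁₂ c₁ k η| + |L₁₂ c₁ k η| +
      |L₂₁ c₂ φ k η| + |L₂₂ c₂ φ k η| := by
    rw [offDiagonal, L₁₃_eq_L₁₂ hm]
    refine (abs_add_le _ _).trans (add_le_add_left ?_ _)
    refine (abs_add_le _ _).trans (add_le_add_left ?_ _)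
    refine (abs_add_le _ _).trans (add_le_add_left ?_ _)
    exact abs_add_le _ _
  -- Three terms with ½⟨c₁⟩e^θ and two with ⟨c₂⟩exp(⟨φ⟩e^θ) add up to β(θ).
  refine h.trans ((add_le_add (add_le_add (add_le_add (add_le_add h1 h2) h2) h4) h5).trans_eq ?_)
  rw [mul_add θ, Real.exp_add, mul_one, β]
  ring

/-- Bochner integrals are additive only for integrable integrands; the weight bounds supply the
integrability at every η. -/
theorem offDiagonal_sub (hk : WeightBound θ C k) (hk' : WeightBound θ C' k') (η : Config d) :
    offDiagonal c₁ c₂ φ (fun ζ => k ζ - k' ζ) η =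
      offDiagonal c₁ c₂ φ k η - offDiagonal c₁ c₂ φ k' η := by
  classical
  have h1 : L₁₁ c₁ (fun ζ => k ζ - k' ζ) η = L₁₁ c₁ k η - L₁₁ c₁ k' η := by
    unfold L₁₁
    rw [integral_kernel_sum_sub (w := fun (z : Space d) (p : Space d × Space d) => c₁ p.1 p.2 z)
      (f := fun (z : Space d) (p : Space d × Space d) => k ⟨(η.points \ {z}) ∪ {p.1, p.2}⟩)
      (g := fun (z : Space d) (p : Space d × Space d) => k' ⟨(η.points \ {z}) ∪ {p.1, p.2}⟩)
      (fun z _ => integrable_c₁_left hm z) (L₁₁_kernel hk η).1 (L₁₁_kernel hk η).2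
      (L₁₁_kernel hk' η).1 (L₁₁_kernel hk' η).2]
    ring
  have h2 : L₁₂ c₁ (fun ζ => k ζ - k' ζ) η = L₁₂ c₁ k η - L₁₂ c₁ k' η := by
    unfold L₁₂
    rw [integral_kernel_sum_sub (w := fun (x : Space d) (p : Space d × Space d) => c₁ x p.1 p.2)
      (f := fun (_ : Space d) (p : Space d × Space d) => k ⟨η.points ∪ {p.1}⟩) (g := fun (_ : Space d) (p : Space d × Space d) => k' ⟨η.points ∪ {p.1}⟩)
      (fun z _ => integrable_c₁_right hm z) (L₁₂_kernel hk η).1 (L₁₂_kernel hk η).2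
      (L₁₂_kernel hk' η).1 (L₁₂_kernel hk' η).2]
    ring
  have h4 : L₂₁ c₂ φ (fun ζ => k ζ - k' ζ) η = L₂₁ c₂ φ k η - L₂₁ c₂ φ k' η := by
    simp only [L₂₁, mul_assoc]
    rw [← integral_kernel_sum_sub (w := fun z x => c₂ (x - z))
      (fun z _ => hm.c₂_integrable.comp_sub_right z) (L₂₁_kernel hm hk η).1 (L₂₁_kernel hm hk η).2
      (L₂₁_kernel hm hk' η).1 (L₂₁_kernel hm hk' η).2]
    simp only [Q_sub hm hk hk', mul_sub]
  have h5 : L₂₂ c₂ φ (fun ζ => k ζ - k' ζ) η = L₂₂ c₂ φ k η - L₂₂ c₂ φ k' η := by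
    simp only [L₂₂, mul_assoc]
    rw [neg_sub_neg, ← neg_sub, ← integral_kernel_sum_sub (w := fun z y => c₂ (z - y))
      (fun z _ => hm.c₂_integrable.comp_sub_left z) (L₂₂_kernel hm hk η).1 (L₂₂_kernel hm hk η).2
      (L₂₂_kernel hm hk' η).1 (L₂₂_kernel hm hk' η).2]
    simp only [Q_sub hm hk hk', mul_sub]
  simp only [offDiagonal, L₁₃_eq_L₁₂ hm, h1, h2, h4, h5]
  ring

end Kernels

end

/-! ### The norm of 𝒦_θ and its N-point parts -/

section

variable {d : ℕ} {θ : ℝ}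

theorem measurable_card : Measurable (Config.card (d := d)) := by
  have h : JointlyMeasurable (d := d) fun (_ : Unit) η => (η.card : ℝ) :=
    JointlyMeasurable.of_injective fun n => ⟨fun _ => n, measurable_const,
      fun _ x hx => by rw [card_ofTuple hx]⟩
  have h1 : Measurable fun η : Config d => (η.card : ℝ) := h.measurable ()
  have h2 : Measurable fun η : Config d => ⌊(η.card : ℝ)⌋₊ := Nat.measurable_floor.comp h1
  simpa using h2

namespace KSpace

theorem norm_le_iff {k : KSpace d θ} {C : ℝ} (hC : 0 ≤ C) :
    ‖k‖ ≤ C ↔ ∀ᵐ η ∂(lebesguePoisson d), |k.1 η| ≤ C * Real.exp (θ * η.card) := by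
  have key : ∀ η : Config d, ‖Real.exp (-θ * η.card) * k.1 η‖ ≤ C ↔
      |k.1 η| ≤ C * Real.exp (θ * η.card) := by
    intro η
    rw [norm_mul, Real.norm_eq_abs, Real.norm_eq_abs, Real.abs_exp, neg_mul, Real.exp_neg,
      inv_mul_le_iff₀ (Real.exp_pos _), mul_comm C]
  have hfin : essSup (fun η : Config d => ‖Real.exp (-θ * η.card) * k.1 η‖ₑ)
      (lebesguePoisson d) ≠ ∞ := by
    have := (KSpace.memLp k).2
    rw [eLpNorm_exponent_top] at this
    exact this.ne
  rw [KSpace.norm_eq]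
  constructor
  · intro h
    have h1 := ENNReal.le_ofReal_iff_toReal_le hfin hC |>.2 h
    filter_upwards [ENNReal.ae_le_essSup
      (fun η : Config d => ‖Real.exp (-θ * η.card) * k.1 η‖ₑ)] with η hη
    rw [← key, ← toReal_enorm]
    exact ENNReal.toReal_le_of_le_ofReal hC (hη.trans h1)
  · intro h
    refine ENNReal.toReal_le_of_le_ofReal hC (essSup_le_of_ae_le _ ?_)
    filter_upwards [h] with η hη
    rw [← key] at hη
    rw [← ofReal_norm]
    exact ENNReal.ofReal_le_ofReal hη

theorem ae_le_norm (k : KSpace d θ) :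
    ∀ᵐ η ∂(lebesguePoisson d), |k.1 η| ≤ ‖k‖ * Real.exp (θ * η.card) :=
  (norm_le_iff (norm_nonneg k)).1 le_rfl

theorem ext_ae {k k' : KSpace d θ} (h : k.1 =ᵐ[lebesguePoisson d] k'.1) : k = k' :=
  Subtype.ext (AEEqFun.ext h)

/-- The element of `𝒦_θ` represented by a function with `|f(η)| ≤ C e^{θ|η|}` almost everywhere. -/
def ofBound (f : Config d → ℝ) (hf : AEStronglyMeasurable f (lebesguePoisson d)) {C : ℝ}
    (hC : ∀ᵐ η ∂(lebesguePoisson d), |f η| ≤ C * Real.exp (θ * η.card)) : KSpace d θ :=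
  ⟨AEEqFun.mk f hf, by
    have hm : Measurable fun η : Config d => Real.exp (-θ * η.card) := by
      have := measurable_card (d := d)
      fun_prop
    refine memLp_top_of_bound (hm.aestronglyMeasurable.mul
      (AEEqFun.mk f hf).stronglyMeasurable.aestronglyMeasurable) C ?_
    filter_upwards [hC, AEEqFun.coeFn_mk f hf] with η h1 h2
    rw [h2, norm_mul, Real.norm_eq_abs, Real.norm_eq_abs, Real.abs_exp, neg_mul, Real.exp_neg,
      inv_mul_le_iff₀ (Real.exp_pos _), mul_comm _ C]
    exact h1⟩

theorem coe_ofBound {f : Config d → ℝ} {hf : AEStronglyMeasurable f (lebesguePoisson d)} {C : ℝ}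
    {hC : ∀ᵐ η ∂(lebesguePoisson d), |f η| ≤ C * Real.exp (θ * η.card)} :
    (ofBound f hf hC).1 =ᵐ[lebesguePoisson d] f :=
  AEEqFun.coeFn_mk f hf

/-- Resetting f to 0 where the bound fails gives a representative that obeys it everywhere, to which
the pointwise estimates apply. -/
theorem exists_weightBound {f : Config d →ₘ[lebesguePoisson d] ℝ} {C : ℝ} (hC : 0 ≤ C)
    (h : ∀ᵐ η ∂(lebesguePoisson d), |f η| ≤ C * Real.exp (θ * η.card)) :
    ∃ k', WeightBound θ C k' ∧ f =ᵐ[lebesguePoisson d] k' := by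
  classical
  refine ⟨fun η => if |f η| ≤ C * Real.exp (θ * η.card) then f η else 0, ⟨?_, fun η => ?_⟩, ?_⟩
  · have h1 := measurable_card (d := d)
    have h2 := f.measurable
    exact Measurable.ite (measurableSet_le (by fun_prop) (by fun_prop)) h2 measurable_const
  · split_ifs with h1
    · exact h1
    · rw [abs_zero]
      positivity
  · filter_upwards [h] with η hη
    rw [if_pos hη]

/-- The restriction of an element of `𝒦_θ` to the configurations of `N` points. -/
def restrictCard (N : ℕ) (k : KSpace d θ) : KSpace d θ :=
  ofBound ({η : Config d | η.card = N}.indicator k.1)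
    (k.1.stronglyMeasurable.indicator
      (measurable_card (measurableSet_singleton N))).aestronglyMeasurable (C := ‖k‖) (by
        filter_upwards [ae_le_norm k] with η hη
        refine le_trans ?_ hη
        rw [indicator_apply]
        split_ifs
        · exact le_rfl
        · simp)

theorem norm_restrictCard_le_iff {N : ℕ} {k : KSpace d θ} {C : ℝ} (hC : 0 ≤ C) :
    ‖restrictCard N k‖ ≤ C ↔ ∀ᵐ η ∂(lebesguePoisson d), η.card = N →
      |k.1 η| ≤ C * Real.exp (θ * N) := by
  rw [norm_le_iff hC]
  refine eventually_congr ?_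
  have h : (restrictCard N k).1 =ᵐ[lebesguePoisson d]
    {η : Config d | η.card = N}.indicator k.1 := coe_ofBound
  filter_upwards [h] with η hη
  rw [hη]
  by_cases hN : η.card = N
  · rw [indicator_of_mem (show η ∈ {η : Config d | η.card = N} from hN)]
    simp [hN]
  · rw [indicator_of_notMem (show η ∉ {η : Config d | η.card = N} from hN)]
    simp only [hN, false_imp_iff, iff_true, abs_zero]
    positivity

theorem ae_le_norm_restrictCard (N : ℕ) (k : KSpace d θ) :
    ∀ᵐ η ∂(lebesguePoisson d), η.card = N → |k.1 η| ≤ ‖restrictCard N k‖ * Real.exp (θ * N) :=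
  (norm_restrictCard_le_iff (norm_nonneg _)).1 le_rfl

theorem coe_sub (k k' : KSpace d θ) :
    (k - k').1 =ᵐ[lebesguePoisson d] fun η => k.1 η - k'.1 η :=
  AEEqFun.coeFn_sub k.1 k'.1

theorem norm_restrictCard_le_add (N : ℕ) (k k' : KSpace d θ) :
    ‖restrictCard N k‖ ≤ ‖restrictCard N k'‖ + ‖k - k'‖ := by
  rw [norm_restrictCard_le_iff (by positivity)]
  filter_upwards [ae_le_norm_restrictCard N k', ae_le_norm (k - k'), coe_sub k k']
    with η h1 h2 h3 hN
  rw [h3, hN] at h2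
  have h4 := h1 hN
  have h5 := abs_sub_abs_le_abs_sub (k.1 η) (k'.1 η)
  rw [add_mul]
  linarith

theorem continuous_norm_restrictCard (N : ℕ) :
    Continuous fun k : KSpace d θ => ‖restrictCard N k‖ := by
  refine LipschitzWith.continuous (K := 1) (LipschitzWith.of_le_add fun k k' => ?_)
  rw [dist_eq_norm]
  exact norm_restrictCard_le_add N k k'

end KSpace

end

/-! ### Uniqueness -/

section

variable {d : ℕ} [NeZero d] {θ : ℝ}
  {c₁ : Space d → Space d → Space d → ℝ} {c₂ φ : Space d → ℝ}

theorem ae_abs_offDiagonal_le (hm : ModelAssumptions c₁ c₂ φ) {f : Config d →ₘ[lebesguePoisson d] ℝ}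
    {C : ℝ} (hC : 0 ≤ C) (h : ∀ᵐ η ∂(lebesguePoisson d), |f η| ≤ C * Real.exp (θ * η.card)) :
    ∀ᵐ η ∂(lebesguePoisson d), |offDiagonal c₁ c₂ φ f η| ≤
      C * β c₁ c₂ φ θ * (η.card * Real.exp (θ * η.card)) := by
  obtain ⟨k, hk, hfk⟩ := KSpace.exists_weightBound hC h
  filter_upwards [offDiagonal_congr (c₁ := c₁) (c₂ := c₂) (φ := φ) hfk] with η hη
  rw [hη]
  exact abs_offDiagonal_le hm hk η

theorem ae_LΔ_sub (hm : ModelAssumptions c₁ c₂ φ) (k k' : KSpace d θ) :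
    ∀ᵐ η ∂(lebesguePoisson d), LΔ c₁ c₂ φ (k - k').1 η =
      LΔ c₁ c₂ φ k.1 η - LΔ c₁ c₂ φ k'.1 η := by
  obtain ⟨g, hg, hkg⟩ := KSpace.exists_weightBound (norm_nonneg k) (KSpace.ae_le_norm k)
  obtain ⟨g', hg', hkg'⟩ := KSpace.exists_weightBound (norm_nonneg k') (KSpace.ae_le_norm k')
  have h : (k - k').1 =ᵐ[lebesguePoisson d] fun η => g η - g' η := by
    filter_upwards [KSpace.coe_sub k k', hkg, hkg'] with η h1 h2 h3
    rw [h1, h2, h3]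
  filter_upwards [LΔ_congr (c₁ := c₁) (c₂ := c₂) (φ := φ) h,
    LΔ_congr (c₁ := c₁) (c₂ := c₂) (φ := φ) hkg,
    LΔ_congr (c₁ := c₁) (c₂ := c₂) (φ := φ) hkg'] with η h1 h2 h3
  rw [h1, h2, h3, LΔ_eq, LΔ_eq, LΔ_eq, offDiagonal_sub hm hg hg']
  ring

/-- An Euler step for `L^Δ` on the configurations of `N` points: the diagonal part `-Ψ` does not
increase the norm. -/
theorem norm_restrictCard_euler_le (hm : ModelAssumptions c₁ c₂ φ) {a a' b : KSpace d θ}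
    {θ' m h D : ℝ} {N : ℕ} (hD : ∀ η : Config d, Ψ c₁ η ≤ D * (η.card : ℝ) ^ 2) (hh : 0 ≤ h)
    (hhD : h * (D * (N : ℝ) ^ 2) ≤ 1) (hm0 : 0 ≤ m)
    (ha : ∀ᵐ η ∂(lebesguePoisson d), |a.1 η| ≤ m * Real.exp (θ' * η.card))
    (ha' : a'.1 =ᵐ[lebesguePoisson d] LΔ c₁ c₂ φ a.1) :
    ‖KSpace.restrictCard N b‖ ≤ ‖KSpace.restrictCard N a‖ +
      h * (m * β c₁ c₂ φ θ' * (N * Real.exp ((θ' - θ) * N))) + ‖b - a - h • a'‖ := by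
  have hβ := β_nonneg hm θ'
  rw [KSpace.norm_restrictCard_le_iff (by positivity)]
  filter_upwards [KSpace.ae_le_norm_restrictCard N a, KSpace.ae_le_norm (b - a - h • a'),
    KSpace.coe_sub (b - a) (h • a'), KSpace.coe_sub b a, AEEqFun.coeFn_smul h a'.1, ha',
    ae_abs_offDiagonal_le hm hm0 ha] with η h1 h2 h3 h4 h5 h6 h7 hN
  have h5' : (h • a').1 η = h * a'.1 η := h5
  rw [h3, h4, h5', hN] at h2
  rw [LΔ_eq] at h6
  rw [hN] at h7
  have hΨ := Ψ_nonneg hm η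
  have hΨ' := hD η
  rw [hN] at hΨ'
  have hhΨ : h * Ψ c₁ η ≤ 1 := (mul_le_mul_of_nonneg_left hΨ' hh).trans hhD
  -- For hΨ ≤ 1 the first coefficient lies in [0, 1]: this is where the sign of -Ψ enters. The last
  -- term is the error of the Euler step.
  have e1 : b.1 η = (1 - h * Ψ c₁ η) * a.1 η + h * offDiagonal c₁ c₂ φ a.1 η +
      (b.1 η - a.1 η - h * a'.1 η) := by
    rw [h6]
    ring
  have e2 : |(1 - h * Ψ c₁ η) * a.1 η| ≤ ‖KSpace.restrictCard N a‖ * Real.exp (θ * N) := by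
    rw [abs_mul, abs_of_nonneg (by linarith)]
    refine (mul_le_of_le_one_left (abs_nonneg _) ?_).trans (h1 hN)
    linarith [mul_nonneg hh hΨ]
  have e3 : |h * offDiagonal c₁ c₂ φ a.1 η| ≤
      h * (m * β c₁ c₂ φ θ' * (N * Real.exp ((θ' - θ) * N))) * Real.exp (θ * N) := by
    rw [abs_mul, abs_of_nonneg hh, mul_assoc]
    refine mul_le_mul_of_nonneg_left (h7.trans_eq ?_) hh
    rw [mul_assoc (m * _), mul_assoc (N : ℝ), ← Real.exp_add]
    ring_nf
  rw [e1, add_mul, add_mul]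
  exact (abs_add_le _ _).trans (add_le_add ((abs_add_le _ _).trans (add_le_add e2 e3)) h2)

/-- On N points the assumed bound limits the growth rate of the norm to mβN e^{r(s-t₀)N}, which is
at most the derivative of (m/2) e^{r(s-t₀)N} because r ≥ 2β. Starting from 0, the norm stays below
that function. The condition r(t₁-t₀) ≤ 1 keeps the exponent below θ + 1, where β is controlled. -/
theorem ae_le_half_of_ae_le (hm : ModelAssumptions c₁ c₂ φ) {w w' : ℝ → KSpace d θ}
    {t₀ t₁ r m : ℝ} (hw : ContinuousOn w (Icc t₀ t₁))
    (hd : ∀ t ∈ Ioo t₀ t₁, HasDerivAt w (w' t) t)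
    (heq : ∀ t ∈ Ioo t₀ t₁, (w' t).1 =ᵐ[lebesguePoisson d] LΔ c₁ c₂ φ (w t).1)
    (h0 : w t₀ = 0) (hr : 2 * β c₁ c₂ φ (θ + 1) ≤ r) (hr1 : r * (t₁ - t₀) ≤ 1) (hm0 : 0 ≤ m)
    (hM : ∀ s ∈ Icc t₀ t₁, ∀ᵐ η ∂(lebesguePoisson d),
      |(w s).1 η| ≤ m * Real.exp ((θ + r * (s - t₀)) * η.card)) :
    ∀ s ∈ Icc t₀ t₁, ∀ᵐ η ∂(lebesguePoisson d),
      |(w s).1 η| ≤ m / 2 * Real.exp ((θ + r * (s - t₀)) * η.card) := by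
  obtain ⟨D, hD0, hD⟩ := exists_Ψ_le hm
  have hr0 : 0 ≤ r := by linarith [β_nonneg hm (θ + 1)]
  have hcont : ∀ N, ContinuousOn (fun s => ‖KSpace.restrictCard N (w s)‖) (Icc t₀ t₁) :=
    fun N => (KSpace.continuous_norm_restrictCard N).comp_continuousOn hw
  have hzero : ∀ N, ‖KSpace.restrictCard N (w t₀)‖ = 0 := by
    intro N
    refine le_antisymm ?_ (norm_nonneg _)
    rw [KSpace.norm_restrictCard_le_iff le_rfl, h0]
    filter_upwards [AEEqFun.coeFn_zero (α := Config d) (β := ℝ) (μ := lebesguePoisson d)]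
      with η hη _
    have : ((0 : KSpace d θ).1 : Config d → ℝ) η = 0 := hη
    rw [this]
    simp
  -- The equation holds only on the open interval, so the comparison starts at e > t₀; afterwards e
  -- tends to t₀.
  have hfence : ∀ (N : ℕ) (e : ℝ), e ∈ Ioo t₀ t₁ → ∀ s ∈ Icc e t₁,
      ‖KSpace.restrictCard N (w s)‖ ≤ ‖KSpace.restrictCard N (w e)‖ +
        m / 2 * Real.exp (r * (s - t₀) * N) := by
    intro N e he s hs
    have hBd : ∀ x, HasDerivAt (fun s => ‖KSpace.restrictCard N (w e)‖ +
        m / 2 * Real.exp (r * (s - t₀) * N))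
        (m / 2 * (Real.exp (r * (x - t₀) * N) * (r * N))) x := by
      intro x
      have h1 : HasDerivAt (fun s : ℝ => r * (s - t₀) * N) (r * N) x := by
        have := (((hasDerivAt_id x).sub_const t₀).const_mul r).mul_const (N : ℝ)
        simpa using this
      exact (h1.exp.const_mul (m / 2)).const_add _
    refine image_le_of_liminf_slope_right_le_deriv_boundary
      (f := fun s => ‖KSpace.restrictCard N (w s)‖) (a := e) (b := t₁)
      (B := fun s => ‖KSpace.restrictCard N (w e)‖ + m / 2 * Real.exp (r * (s - t₀) * N))
      (B' := fun x => m / 2 * (Real.exp (r * (x - t₀) * N) * (r * N)))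
      ((hcont N).mono (Icc_subset_Icc_left he.1.le)) ?_
      (fun x _ => (hBd x).continuousAt.continuousWithinAt)
      (fun x _ => (hBd x).hasDerivWithinAt) ?_ hs
    · have : 0 ≤ m / 2 * Real.exp (r * (e - t₀) * N) := by positivity
      simpa using this
    · intro x hx q hq
      have hx' : x ∈ Ioo t₀ t₁ := ⟨he.1.trans_le hx.1, hx.2⟩
      have hθ' : θ + r * (x - t₀) ≤ θ + 1 := by
        have : r * (x - t₀) ≤ r * (t₁ - t₀) :=
          mul_le_mul_of_nonneg_left (by linarith [hx.2]) hr0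
        linarith
      set B' := m / 2 * (Real.exp (r * (x - t₀) * N) * (r * N)) with hB'
      have hg : m * β c₁ c₂ φ (θ + r * (x - t₀)) *
          (N * Real.exp ((θ + r * (x - t₀) - θ) * N)) ≤ B' := by
        have h1 : β c₁ c₂ φ (θ + r * (x - t₀)) ≤ r / 2 := by
          linarith [β_mono hm hθ']
        rw [add_sub_cancel_left]
        calc _ ≤ m * (r / 2) * (N * Real.exp (r * (x - t₀) * N)) := by gcongr
          _ = B' := by rw [hB']; ring
      -- Half of the gap between q and B' is given to the differentiation error, which leaves the
      -- slope strictly below q.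
      have hlo := (hd x hx').isLittleO.def (c := (q - B') / 2) (by linarith)
      -- With N fixed Ψ is bounded by DN², so short steps satisfy hΨ ≤ 1. No step would do for all
      -- configurations at once when Ψ is unbounded, hence the separate treatment of each N.
      have hstep : ∀ᶠ z in 𝓝[>] x, (z - x) * (D * (N : ℝ) ^ 2) ≤ 1 := by
        have hc : ContinuousAt (fun z => (z - x) * (D * (N : ℝ) ^ 2)) x := by fun_prop
        have := hc.eventually_lt (continuousAt_const (y := (1 : ℝ))) (by simp)
        exact (this.filter_mono nhdsWithin_le_nhds).mono fun z hz => hz.le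
      refine Eventually.frequently ?_
      filter_upwards [hlo.filter_mono nhdsWithin_le_nhds, hstep, self_mem_nhdsWithin]
        with z h1 h2 h3
      have h3' : 0 < z - x := sub_pos.2 h3
      have h4 := norm_restrictCard_euler_le hm (N := N) (b := w z) hD h3'.le h2 hm0
        (hM x ⟨hx'.1.le, hx'.2.le⟩) (heq x hx')
      rw [Real.norm_eq_abs, abs_of_pos h3'] at h1
      have h5 := mul_le_mul_of_nonneg_left hg h3'.le
      rw [slope_def_field, div_lt_iff₀ h3']
      nlinarith
  intro s hs
  have hbound : ∀ N : ℕ, ‖KSpace.restrictCard N (w s)‖ ≤ m / 2 * Real.exp (r * (s - t₀) * N) := by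
    intro N
    have hpos : 0 ≤ m / 2 * Real.exp (r * (s - t₀) * N) := by positivity
    rcases hs.1.eq_or_lt with rfl | hlt
    · rwa [hzero]
    · have hlim : Tendsto (fun e => ‖KSpace.restrictCard N (w e)‖ +
          m / 2 * Real.exp (r * (s - t₀) * N)) (𝓝[>] t₀)
          (𝓝 (0 + m / 2 * Real.exp (r * (s - t₀) * N))) := by
        refine Tendsto.add_const _ ?_
        have h1 := (hcont N t₀ ⟨le_rfl, hs.1.trans hs.2⟩).tendsto
        rw [hzero] at h1
        refine h1.mono_left ?_
        rw [← nhdsWithin_Ioc_eq_nhdsGT (hlt.trans_le hs.2)]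
        exact nhdsWithin_mono _ Ioc_subset_Icc_self
      rw [zero_add] at hlim
      refine ge_of_tendsto hlim ?_
      filter_upwards [Ioo_mem_nhdsGT hlt] with e he
      exact hfence N e ⟨he.1, he.2.trans_le hs.2⟩ s ⟨he.2.le, hs.2⟩
  have hall : ∀ᵐ η ∂(lebesguePoisson d), ∀ N : ℕ, η.card = N →
      |(w s).1 η| ≤ m / 2 * Real.exp (r * (s - t₀) * N) * Real.exp (θ * N) :=
    ae_all_iff.2 fun N => (KSpace.norm_restrictCard_le_iff (by positivity)).1 (hbound N)
  filter_upwards [hall] with η hη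
  refine (hη _ rfl).trans_eq ?_
  rw [mul_assoc, ← Real.exp_add, add_mul, add_comm]

theorem eq_zero_of_hasDerivAt_LΔ (hm : ModelAssumptions c₁ c₂ φ) {w w' : ℝ → KSpace d θ}
    {t₀ t₁ r : ℝ} (hw : ContinuousOn w (Icc t₀ t₁))
    (hd : ∀ t ∈ Ioo t₀ t₁, HasDerivAt w (w' t) t)
    (heq : ∀ t ∈ Ioo t₀ t₁, (w' t).1 =ᵐ[lebesguePoisson d] LΔ c₁ c₂ φ (w t).1)
    (h0 : w t₀ = 0) (hr : 2 * β c₁ c₂ φ (θ + 1) ≤ r) (hr1 : r * (t₁ - t₀) ≤ 1) :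
    ∀ s ∈ Icc t₀ t₁, w s = 0 := by
  have hr0 : 0 ≤ r := by linarith [β_nonneg hm (θ + 1)]
  -- The supremum of the norm starts the iteration; each round halves it. |M| is used because M may
  -- be negative when the interval is empty.
  obtain ⟨M, hM⟩ := isCompact_Icc.exists_bound_of_continuousOn hw
  have hiter : ∀ n : ℕ, ∀ s ∈ Icc t₀ t₁, ∀ᵐ η ∂(lebesguePoisson d),
      |(w s).1 η| ≤ |M| / 2 ^ n * Real.exp ((θ + r * (s - t₀)) * η.card) := by
    intro n
    induction n with
    | zero =>
      intro s hs
      filter_upwards [KSpace.ae_le_norm (w s)] with η hη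
      refine hη.trans ?_
      rw [pow_zero, div_one]
      have h1 : ‖w s‖ ≤ |M| := (hM s hs).trans (le_abs_self M)
      have h2 : 0 ≤ r * (s - t₀) := mul_nonneg hr0 (by linarith [hs.1])
      gcongr
      linarith
    | succ n ih =>
      intro s hs
      rw [pow_succ, ← div_div]
      exact ae_le_half_of_ae_le hm hw hd heq h0 hr hr1 (by positivity) ih s hs
  intro s hs
  refine KSpace.ext_ae ?_
  filter_upwards [ae_all_iff.2 fun n => hiter n s hs,
    AEEqFun.coeFn_zero (α := Config d) (β := ℝ) (μ := lebesguePoisson d)] with η h1 h2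
  have h2' : ((0 : KSpace d θ).1 : Config d → ℝ) η = 0 := h2
  rw [h2', ← abs_nonpos_iff]
  have hlim : Tendsto (fun n : ℕ => |M| / 2 ^ n * Real.exp ((θ + r * (s - t₀)) * η.card)) atTop
      (𝓝 0) := by
    have := (tendsto_pow_atTop_nhds_zero_of_lt_one (r := (1 / 2 : ℝ)) (by norm_num)
      (by norm_num)).const_mul (|M| * Real.exp ((θ + r * (s - t₀)) * η.card))
    rw [mul_zero] at this
    refine this.congr fun n => ?_
    rw [one_div, inv_pow]
    ring
  exact ge_of_tendsto' hlim h1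

theorem IsClassicalSolution.unique (hm : ModelAssumptions c₁ c₂ φ) {τ : ℝ≥0∞}
    {k₀ : Config d →ₘ[lebesguePoisson d] ℝ} {k k' : ℝ → KSpace d θ}
    (hk : IsClassicalSolution c₁ c₂ φ θ τ k₀ k) (hk' : IsClassicalSolution c₁ c₂ φ θ τ k₀ k')
    (t : ℝ) (ht0 : 0 ≤ t) (ht : ENNReal.ofReal t < τ) : k' t = k t := by
  -- The added 1 keeps the step length 1/r finite when β vanishes.
  set r := 2 * β c₁ c₂ φ (θ + 1) + 1 with hr
  have hr0 : 0 < r := by linarith [β_nonneg hm (θ + 1)]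
  have hstep : ∀ t₀ t₁, 0 ≤ t₀ → t₀ ≤ t₁ → ENNReal.ofReal t₁ < τ → r * (t₁ - t₀) ≤ 1 →
      k' t₀ = k t₀ → k' t₁ = k t₁ := by
    intro t₀ t₁ h0 h01 h1 hr1 heq
    have hlt : ∀ s ≤ t₁, ENNReal.ofReal s < τ := fun s hs =>
      (ENNReal.ofReal_le_ofReal hs).trans_lt h1
    have hsub : Icc t₀ t₁ ⊆ {t | 0 ≤ t ∧ ENNReal.ofReal t < τ} := fun s hs =>
      ⟨h0.trans hs.1, hlt s hs.2⟩
    refine sub_eq_zero.1 (eq_zero_of_hasDerivAt_LΔ hm (w := fun t => k' t - k t)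
      (w' := fun t => deriv k' t - deriv k t) (r := r)
      ((hk'.continuousOn.mono hsub).sub (hk.continuousOn.mono hsub)) ?_ ?_ (sub_eq_zero.2 heq)
      (by linarith) hr1 t₁ ⟨h01, le_rfl⟩)
    · intro s hs
      have hs0 : 0 < s := h0.trans_lt hs.1
      exact (hk'.differentiableAt s hs0 (hlt s hs.2.le)).hasDerivAt.sub
        (hk.differentiableAt s hs0 (hlt s hs.2.le)).hasDerivAt
    · intro s hs
      have hs0 : 0 < s := h0.trans_lt hs.1
      filter_upwards [hk'.equation s hs0 (hlt s hs.2.le), hk.equation s hs0 (hlt s hs.2.le),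
        KSpace.coe_sub (deriv k' s) (deriv k s), ae_LΔ_sub hm (k' s) (k s)] with η e1 e2 e3 e4
      rw [e3, e4, e1, e2]
  -- Advance in steps of the full length 1/r, as r depends only on θ and the model; one last shorter
  -- step goes from ⌊rt⌋/r to t.
  have hind : ∀ n : ℕ, (n : ℝ) / r ≤ t → k' (n / r) = k (n / r) := by
    intro n
    induction n with
    | zero =>
      intro _
      simp only [Nat.cast_zero, zero_div]
      exact Subtype.ext (hk'.initial.trans hk.initial.symm)
    | succ n ih =>
      intro h
      have h1 : (n : ℝ) / r ≤ ((n + 1 : ℕ) : ℝ) / r := by gcongr; simp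
      refine hstep _ _ (by positivity) h1 ((ENNReal.ofReal_le_ofReal h).trans_lt ht) ?_
        (ih (h1.trans h))
      refine le_of_eq ?_
      push_cast
      field_simp
      ring
  have hfl := Nat.floor_le (mul_nonneg hr0.le ht0)
  have hfl' := (Nat.lt_floor_add_one (r * t)).le
  have h1 : (⌊r * t⌋₊ : ℝ) / r ≤ t := by
    rw [div_le_iff₀ hr0]
    linarith
  refine hstep _ _ (by positivity) h1 ht ?_ (hind _ h1)
  rw [mul_sub, mul_div_cancel₀ _ hr0.ne']
  linarith

end

/-! ### The Duhamel equation by Picard iteration -/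

section

variable {d : ℕ} {c₁ : Space d → Space d → Space d → ℝ} {c₂ φ : Space d → ℝ} {k₀ : Config d → ℝ}
  {u v : ℝ → Config d → ℝ}

/-- The right-hand side of the Duhamel equation, evaluated at each configuration. -/
def picardMap (c₁ : Space d → Space d → Space d → ℝ) (c₂ φ : Space d → ℝ) (k₀ : Config d → ℝ)
    (u : ℝ → Config d → ℝ) (t : ℝ) (η : Config d) : ℝ :=
  Real.exp (-(t * Ψ c₁ η)) *
    (k₀ η + ∫ s in Ioc 0 t, Real.exp (s * Ψ c₁ η) * offDiagonal c₁ c₂ φ (u s) η)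

/-- The Picard iterates of the Duhamel equation. -/
def picard (c₁ : Space d → Space d → Space d → ℝ) (c₂ φ : Space d → ℝ) (k₀ : Config d → ℝ) :
    ℕ → ℝ → Config d → ℝ
  | 0 => fun _ _ => 0
  | n + 1 => picardMap c₁ c₂ φ k₀ (picard c₁ c₂ φ k₀ n)

/-- The pointwise limit of the Picard iterates. -/
def duhamelSolution (c₁ : Space d → Space d → Space d → ℝ) (c₂ φ : Space d → ℝ)
    (k₀ : Config d → ℝ) (t : ℝ) (η : Config d) : ℝ :=
  limUnder atTop fun n => picard c₁ c₂ φ k₀ n t η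

theorem jointlyMeasurable_picardMap (hm : ModelAssumptions c₁ c₂ φ) (hk₀ : Measurable k₀)
    (hu : JointlyMeasurable u) : JointlyMeasurable (picardMap c₁ c₂ φ k₀ u) := by
  intro n
  have hΨ : Measurable fun x : Fin n → Space d => Ψ c₁ (ofTuple n x) :=
    (measurable_Ψ hm).comp (measurable_ofTuple n)
  have hk : Measurable fun x : Fin n → Space d => k₀ (ofTuple n x) :=
    hk₀.comp (measurable_ofTuple n)
  have hB : Measurable fun q : ℝ × (Fin n → Space d) =>
      offDiagonal c₁ c₂ φ (u q.1) (ofTuple n q.2) := hu.offDiagonal hm n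
  have hint : Measurable fun q : ℝ × (Fin n → Space d) => ∫ s, (Ioc 0 q.1).indicator
      (fun s => Real.exp (s * Ψ c₁ (ofTuple n q.2)) *
        offDiagonal c₁ c₂ φ (u s) (ofTuple n q.2)) s := by
    refine measurable_integral_of_uncurry ?_
    have hB' : Measurable fun r : (ℝ × (Fin n → Space d)) × ℝ =>
        offDiagonal c₁ c₂ φ (u r.2) (ofTuple n r.1.2) :=
      hB.comp (f := fun r : (ℝ × (Fin n → Space d)) × ℝ => (r.2, r.1.2)) (by fun_prop)
    have hΨ' : Measurable fun r : (ℝ × (Fin n → Space d)) × ℝ => Ψ c₁ (ofTuple n r.1.2) :=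
      hΨ.comp (f := fun r : (ℝ × (Fin n → Space d)) × ℝ => r.1.2) (by fun_prop)
    have h1 := (Real.measurable_exp.comp (measurable_snd.mul hΨ')).mul hB'
    have h2 : MeasurableSet {r : (ℝ × (Fin n → Space d)) × ℝ | 0 < r.2 ∧ r.2 ≤ r.1.1} :=
      (measurableSet_lt measurable_const measurable_snd).inter
        (measurableSet_le measurable_snd (measurable_fst.comp measurable_fst))
    convert h1.indicator h2 using 1
    ext r
    simp only [indicator_apply]
    rfl
  simp only [integral_indicator measurableSet_Ioc] at hint
  exact Measurable.mul (Real.measurable_exp.comp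
    (measurable_fst.mul (hΨ.comp measurable_snd)).neg) ((hk.comp measurable_snd).add hint)

theorem jointlyMeasurable_picard (hm : ModelAssumptions c₁ c₂ φ) (hk₀ : Measurable k₀) (n : ℕ) :
    JointlyMeasurable (picard c₁ c₂ φ k₀ n) := by
  induction n with
  | zero => exact fun _ => measurable_const
  | succ n ih => exact jointlyMeasurable_picardMap hm hk₀ ih

theorem jointlyMeasurable_duhamelSolution (hm : ModelAssumptions c₁ c₂ φ) (hk₀ : Measurable k₀) :
    JointlyMeasurable (duhamelSolution c₁ c₂ φ k₀) := fun n =>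
  (StronglyMeasurable.limUnder fun m =>
    (jointlyMeasurable_picard hm hk₀ m n).stronglyMeasurable).measurable

theorem weightBound_zero (θ : ℝ) : WeightBound θ 0 fun _ : Config d => 0 :=
  ⟨measurable_const, fun η => by simp⟩

/-- The integrand is the derivative of e^{(α+bs)n}/b. Here the factor |η| lost by B is exchanged for
1/b, uniformly in the number of points. -/
theorem integral_card_mul_exp_le {α b t : ℝ} (hb : 0 < b) (ht : 0 ≤ t) (n : ℕ) :
    ∫ s in Ioc 0 t, (n : ℝ) * Real.exp ((α + b * s) * n) ≤ Real.exp ((α + b * t) * n) / b := by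
  have hder : ∀ s ∈ uIcc 0 t, HasDerivAt (fun s => Real.exp ((α + b * s) * n) / b)
      ((n : ℝ) * Real.exp ((α + b * s) * n)) s := by
    intro s _
    have h1 : HasDerivAt (fun s => (α + b * s) * n) (b * n) s := by
      simpa using (((hasDerivAt_id s).const_mul b).const_add α).mul_const (n : ℝ)
    have h2 := h1.exp.div_const b
    rwa [show Real.exp ((α + b * s) * n) * (b * n) / b = (n : ℝ) * Real.exp ((α + b * s) * n) by
      field_simp] at h2
  rw [← intervalIntegral.integral_of_le ht, intervalIntegral.integral_eq_sub_of_hasDerivAt hder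
    (Continuous.intervalIntegrable (by fun_prop) _ _)]
  have : 0 < Real.exp ((α + b * 0) * n) / b := by positivity
  linarith

section Contraction

variable [NeZero d] (hm : ModelAssumptions c₁ c₂ φ)
include hm

theorem integrableOn_exp_mul_offDiagonal {θ K T : ℝ} (hu : JointlyMeasurable u)
    (huK : ∀ s ∈ Icc 0 T, WeightBound θ K (u s)) (η : Config d) :
    IntegrableOn (fun s => Real.exp (s * Ψ c₁ η) * offDiagonal c₁ c₂ φ (u s) η) (Ioc 0 T) := by
  have hmeas : Measurable fun s => Real.exp (s * Ψ c₁ η) * offDiagonal c₁ c₂ φ (u s) η :=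
    Measurable.mul (by fun_prop) ((hu.offDiagonal hm).measurable_left η)
  refine Measure.integrableOn_of_bounded (M := Real.exp (T * Ψ c₁ η) *
    (K * β c₁ c₂ φ θ * (η.card * Real.exp (θ * η.card)))) (by simp)
    hmeas.aestronglyMeasurable ?_
  filter_upwards [ae_restrict_mem measurableSet_Ioc] with s hs
  rw [norm_mul, Real.norm_eq_abs, Real.norm_eq_abs, Real.abs_exp]
  have h1 := abs_offDiagonal_le hm (huK s ⟨hs.1.le, hs.2⟩) η
  have h2 := Ψ_nonneg hm η
  gcongr
  exact hs.2

/-- With a weight exponent growing at speed `b`, the Duhamel map has Lipschitz constant `β / b`. -/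
theorem abs_picardMap_sub_le {α b T K K' M : ℝ} (hb : 0 < b)
    (hu : JointlyMeasurable u) (hv : JointlyMeasurable v)
    (huK : ∀ s ∈ Icc 0 T, WeightBound (α + b * s) K (u s))
    (hvK : ∀ s ∈ Icc 0 T, WeightBound (α + b * s) K' (v s))
    (hM : ∀ s ∈ Icc 0 T, ∀ η, |u s η - v s η| ≤ M * Real.exp ((α + b * s) * η.card))
    {t : ℝ} (ht : t ∈ Icc 0 T) (η : Config d) :
    |picardMap c₁ c₂ φ k₀ u t η - picardMap c₁ c₂ φ k₀ v t η| ≤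
      β c₁ c₂ φ (α + b * T) / b * M * Real.exp ((α + b * t) * η.card) := by
  have hΨ := Ψ_nonneg hm η
  have hle : ∀ s ∈ Icc 0 T, α + b * s ≤ α + b * T := fun s hs => by
    have := mul_le_mul_of_nonneg_left hs.2 hb.le
    linarith
  have hM0 : 0 ≤ M := by
    have := (abs_nonneg _).trans (hM t ht ⟨∅⟩)
    exact nonneg_of_mul_nonneg_left this (Real.exp_pos _)
  have hsub : Ioc 0 t ⊆ Ioc 0 T := Ioc_subset_Ioc_right ht.2
  have hiu := (integrableOn_exp_mul_offDiagonal hm hu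
    (fun s hs => (huK s hs).mono (hle s hs) le_rfl) η).mono_set hsub
  have hiv := (integrableOn_exp_mul_offDiagonal hm hv
    (fun s hs => (hvK s hs).mono (hle s hs) le_rfl) η).mono_set hsub
  have e1 : picardMap c₁ c₂ φ k₀ u t η - picardMap c₁ c₂ φ k₀ v t η =
      Real.exp (-(t * Ψ c₁ η)) * ∫ s in Ioc 0 t, Real.exp (s * Ψ c₁ η) *
        offDiagonal c₁ c₂ φ (fun ζ => u s ζ - v s ζ) η := by
    have : ∫ s in Ioc 0 t, Real.exp (s * Ψ c₁ η) *
        offDiagonal c₁ c₂ φ (fun ζ => u s ζ - v s ζ) η =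
        (∫ s in Ioc 0 t, Real.exp (s * Ψ c₁ η) * offDiagonal c₁ c₂ φ (u s) η) -
          ∫ s in Ioc 0 t, Real.exp (s * Ψ c₁ η) * offDiagonal c₁ c₂ φ (v s) η := by
      rw [← integral_sub hiu hiv]
      refine setIntegral_congr_fun measurableSet_Ioc fun s hs => ?_
      have hs' : s ∈ Icc 0 T := ⟨hs.1.le, hs.2.trans ht.2⟩
      simp only [offDiagonal_sub hm (huK s hs') (hvK s hs'), mul_sub]
    rw [this]
    simp only [picardMap]
    ring
  -- For s ≤ t, e^{sΨ} ≤ e^{tΨ}, which the prefactor e^{-tΨ} later cancels; the diagonal part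
  -- therefore leaves no trace in the constant.
  have e2 : ‖∫ s in Ioc 0 t, Real.exp (s * Ψ c₁ η) *
      offDiagonal c₁ c₂ φ (fun ζ => u s ζ - v s ζ) η‖ ≤
      ∫ s in Ioc 0 t, Real.exp (t * Ψ c₁ η) * (M * β c₁ c₂ φ (α + b * T)) *
        (η.card * Real.exp ((α + b * s) * η.card)) := by
    refine norm_integral_le_of_norm_le ?_ ?_
    · exact (Continuous.integrableOn_Icc (by fun_prop)).mono_set Ioc_subset_Icc_self
    · filter_upwards [ae_restrict_mem measurableSet_Ioc] with s hs
      have hs' : s ∈ Icc 0 T := ⟨hs.1.le, hs.2.trans ht.2⟩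
      have h1 := abs_offDiagonal_le hm (θ := α + b * s) (C := M)
        ⟨((huK s hs').measurable.sub (hvK s hs').measurable), hM s hs'⟩ η
      have h2 := β_mono hm (hle s hs')
      have h3 := β_nonneg hm (α + b * s)
      rw [norm_mul, Real.norm_eq_abs, Real.norm_eq_abs, Real.abs_exp, mul_assoc]
      refine mul_le_mul ?_ (h1.trans ?_) (abs_nonneg _) (Real.exp_pos _).le
      · gcongr
        exact hs.2
      · gcongr
  rw [integral_const_mul] at e2
  have e3 := integral_card_mul_exp_le (α := α) hb ht.1 η.card
  have hβ := β_nonneg hm (α + b * T)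
  rw [e1, abs_mul, Real.abs_exp]
  calc _ ≤ Real.exp (-(t * Ψ c₁ η)) * (Real.exp (t * Ψ c₁ η) * (M * β c₁ c₂ φ (α + b * T)) *
        (Real.exp ((α + b * t) * η.card) / b)) := by
        refine mul_le_mul_of_nonneg_left (e2.trans ?_) (Real.exp_pos _).le
        gcongr
    _ = (Real.exp (-(t * Ψ c₁ η)) * Real.exp (t * Ψ c₁ η)) * (β c₁ c₂ φ (α + b * T) / b * M *
        Real.exp ((α + b * t) * η.card)) := by ring
    _ = _ := by rw [← Real.exp_add, neg_add_cancel, Real.exp_zero, one_mul]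

theorem abs_picardMap_zero_le {α b C t : ℝ} (hb : 0 < b) (hk₀ : WeightBound α C k₀)
    (ht : 0 ≤ t) (η : Config d) :
    |picardMap c₁ c₂ φ k₀ (fun _ _ => 0) t η| ≤ C * Real.exp ((α + b * t) * η.card) := by
  have h0 : offDiagonal c₁ c₂ φ (fun _ => 0) η = 0 := by
    have := abs_offDiagonal_le hm (weightBound_zero α) η
    simpa using this
  have hΨ := Ψ_nonneg hm η
  simp only [picardMap, h0, mul_zero, integral_zero, add_zero]
  rw [abs_mul, Real.abs_exp]
  refine (mul_le_of_le_one_left (abs_nonneg _) (Real.exp_le_one_iff.2 ?_)).trans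
    ((hk₀.le η).trans ?_)
  · have := mul_nonneg ht hΨ
    linarith
  · have := hk₀.nonneg
    have : 0 ≤ b * t := by positivity
    gcongr
    linarith

/-- The constant C/(1-q) solves K = C + qK: the initial datum contributes C and the integral term at
most q times the previous bound. -/
theorem weightBound_picard {α b T C q : ℝ} (hb : 0 < b) (hk₀ : WeightBound α C k₀)
    (hq : β c₁ c₂ φ (α + b * T) / b ≤ q) (hq1 : q < 1) (n : ℕ) :
    ∀ t ∈ Icc 0 T, WeightBound (α + b * t) (C / (1 - q)) (picard c₁ c₂ φ k₀ n t) := by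
  have hC := hk₀.nonneg
  have h1q : 0 < 1 - q := by linarith
  induction n with
  | zero => exact fun t _ => (weightBound_zero _).mono le_rfl (by positivity)
  | succ n ih =>
    intro t ht
    refine ⟨(jointlyMeasurable_picard hm hk₀.measurable (n + 1)).measurable t, fun η => ?_⟩
    have h1 := abs_picardMap_sub_le hm (k₀ := k₀) hb (jointlyMeasurable_picard hm hk₀.measurable n)
      (v := fun _ _ => 0) (fun _ => measurable_const) ih
      (fun s _ => weightBound_zero _) (M := C / (1 - q))
      (fun s hs η => by simpa using (ih s hs).le η) ht η
    have h2 := abs_picardMap_zero_le hm hb hk₀ ht.1 η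
    have h3 : β c₁ c₂ φ (α + b * T) / b * (C / (1 - q)) * Real.exp ((α + b * t) * η.card) ≤
        q * (C / (1 - q)) * Real.exp ((α + b * t) * η.card) := by gcongr
    have h4 : C / (1 - q) = C + q * (C / (1 - q)) := by
      field_simp
      ring
    change |picardMap c₁ c₂ φ k₀ (picard c₁ c₂ φ k₀ n) t η| ≤ _
    rw [h4, add_mul]
    have h5 := abs_sub_abs_le_abs_sub (picardMap c₁ c₂ φ k₀ (picard c₁ c₂ φ k₀ n) t η)
      (picardMap c₁ c₂ φ k₀ (fun _ _ => 0) t η)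
    linarith

theorem abs_picard_succ_sub_le {α b T C q : ℝ} (hb : 0 < b) (hk₀ : WeightBound α C k₀)
    (hq : β c₁ c₂ φ (α + b * T) / b ≤ q) (hq1 : q < 1) (hq0 : 0 ≤ q) (n : ℕ) :
    ∀ t ∈ Icc 0 T, ∀ η, |picard c₁ c₂ φ k₀ (n + 1) t η - picard c₁ c₂ φ k₀ n t η| ≤
      C * q ^ n * Real.exp ((α + b * t) * η.card) := by
  have hC := hk₀.nonneg
  induction n with
  | zero =>
    intro t ht η
    have := abs_picardMap_zero_le hm hb hk₀ ht.1 η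
    simpa [picard] using this
  | succ n ih =>
    intro t ht η
    refine (abs_picardMap_sub_le hm (k₀ := k₀) hb (jointlyMeasurable_picard hm hk₀.measurable _)
      (jointlyMeasurable_picard hm hk₀.measurable _) (weightBound_picard hm hb hk₀ hq hq1 _)
      (weightBound_picard hm hb hk₀ hq hq1 _) ih ht η).trans ?_
    calc _ ≤ q * (C * q ^ n) * Real.exp ((α + b * t) * η.card) := by gcongr
      _ = _ := by ring

/-- The Picard iterates converge geometrically at each (t, η), uniformly in the weight. Their limit
depends on neither b nor T, so the solutions obtained for different choices need no gluing. -/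
theorem duhamelSolution_of_contraction {α b T C : ℝ} (hb : 0 < b) (hk₀ : WeightBound α C k₀)
    (hβ : β c₁ c₂ φ (α + b * T) < b) :
    ∃ K, ∀ t ∈ Icc 0 T, WeightBound (α + b * t) K (duhamelSolution c₁ c₂ φ k₀ t) ∧
      ∀ η, duhamelSolution c₁ c₂ φ k₀ t η =
        picardMap c₁ c₂ φ k₀ (duhamelSolution c₁ c₂ φ k₀) t η := by
  set q := β c₁ c₂ φ (α + b * T) / b with hq
  have hC := hk₀.nonneg
  have hq0 : 0 ≤ q := div_nonneg (β_nonneg hm _) hb.le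
  have hq1 : q < 1 := (div_lt_one hb).2 hβ
  have h1q : 0 < 1 - q := by linarith
  have hdist : ∀ t ∈ Icc 0 T, ∀ η n,
      dist (picard c₁ c₂ φ k₀ n t η) (picard c₁ c₂ φ k₀ (n + 1) t η) ≤
        C * Real.exp ((α + b * t) * η.card) * q ^ n := by
    intro t ht η n
    rw [dist_comm, Real.dist_eq]
    refine (abs_picard_succ_sub_le hm hb hk₀ le_rfl hq1 hq0 n t ht η).trans_eq (by ring)
  have hlim : ∀ t ∈ Icc 0 T, ∀ η, Tendsto (fun n => picard c₁ c₂ φ k₀ n t η) atTop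
      (𝓝 (duhamelSolution c₁ c₂ φ k₀ t η)) := fun t ht η =>
    (cauchySeq_of_le_geometric q _ hq1 (hdist t ht η)).tendsto_limUnder
  have hbd : ∀ t ∈ Icc 0 T, WeightBound (α + b * t) (C / (1 - q))
      (duhamelSolution c₁ c₂ φ k₀ t) := fun t ht =>
    ⟨(jointlyMeasurable_duhamelSolution hm hk₀.measurable).measurable t, fun η =>
      le_of_tendsto (hlim t ht η).abs (Eventually.of_forall fun n =>
        (weightBound_picard hm hb hk₀ le_rfl hq1 n t ht).le η)⟩
  refine ⟨C / (1 - q), fun t ht => ⟨hbd t ht, fun η => ?_⟩⟩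
  -- The shifted iterates tend to the limit, and by the Lipschitz bound of the Duhamel map also to
  -- its value at the limit.
  refine tendsto_nhds_unique ((tendsto_add_atTop_iff_nat 1).2 (hlim t ht η)) ?_
  rw [tendsto_iff_dist_tendsto_zero]
  have hgeom : Tendsto (fun n : ℕ => q * (C / (1 - q) * q ^ n) *
      Real.exp ((α + b * t) * η.card)) atTop (𝓝 0) := by
    have := (tendsto_pow_atTop_nhds_zero_of_lt_one hq0 hq1).const_mul
      (q * (C / (1 - q)) * Real.exp ((α + b * t) * η.card))
    rw [mul_zero] at this
    exact this.congr fun n => by ring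
  refine squeeze_zero (fun _ => dist_nonneg) (fun n => ?_) hgeom
  refine abs_picardMap_sub_le hm hb (jointlyMeasurable_picard hm hk₀.measurable n)
    (jointlyMeasurable_duhamelSolution hm hk₀.measurable)
    (weightBound_picard hm hb hk₀ le_rfl hq1 n) hbd (fun s hs ζ => ?_) ht η
  have := dist_le_of_le_geometric_of_tendsto q _ hq1 (hdist s hs ζ) (hlim s hs ζ) n
  rw [Real.dist_eq] at this
  exact this.trans_eq (by ring)

/-- The solution of the Duhamel equation exists, with a uniform bound of exponent `< α'`, on every
`[0, τ]` with `τ β(α') < α' - α`. -/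
theorem exists_duhamelSolution_bound {α α' C τ : ℝ} (hk₀ : WeightBound α C k₀) (hτ0 : 0 ≤ τ)
    (hτ : τ * β c₁ c₂ φ α' < α' - α) :
    ∃ θ < α', ∃ K, ∀ t ∈ Icc 0 τ, WeightBound θ K (duhamelSolution c₁ c₂ φ k₀ t) ∧
      ∀ η, duhamelSolution c₁ c₂ φ k₀ t η =
        picardMap c₁ c₂ φ k₀ (duhamelSolution c₁ c₂ φ k₀) t η := by
  set b₀ := β c₁ c₂ φ α' with hb₀
  have hb₀0 : 0 ≤ b₀ := β_nonneg hm α'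
  -- The speed is b = β(α') + ε. Dividing the slack by τ + 1 rather than τ makes α + bτ = α' - ε <
  -- α', and is harmless at τ = 0.
  set ε := (α' - α - τ * b₀) / (τ + 1) with hε
  have hε0 : 0 < ε := div_pos (by linarith) (by linarith)
  have hετ : ε * (τ + 1) = α' - α - τ * b₀ := div_mul_cancel₀ _ (by linarith)
  have hb : 0 < b₀ + ε := by linarith
  have hlt : α + (b₀ + ε) * τ < α' := by nlinarith
  obtain ⟨K, hK⟩ := duhamelSolution_of_contraction hm (T := τ) hb hk₀
    ((β_mono hm hlt.le).trans_lt (by linarith))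
  refine ⟨_, hlt, K, fun t ht => ⟨(hK t ht).1.mono ?_ le_rfl, (hK t ht).2⟩⟩
  have := mul_le_mul_of_nonneg_left ht.2 hb.le
  linarith

end Contraction

end

/-! ### Regularity of the Duhamel solution -/

section

variable {d : ℕ} {c₁ : Space d → Space d → Space d → ℝ} {c₂ φ : Space d → ℝ} {k₀ : Config d → ℝ}
  {u : ℝ → Config d → ℝ}

theorem exists_sq_mul_exp_le {θ θ' : ℝ} (h : θ < θ') :
    ∃ A, 0 ≤ A ∧ ∀ n : ℕ, (n : ℝ) ^ 2 * Real.exp (θ * n) ≤ A * Real.exp (θ' * n) := by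
  have hδ : 0 < θ' - θ := sub_pos.2 h
  refine ⟨2 / (θ' - θ) ^ 2, by positivity, fun n => ?_⟩
  have h1 := Real.pow_div_factorial_le_exp ((θ' - θ) * n) (by positivity) 2
  have h2 : (n : ℝ) ^ 2 ≤ 2 / (θ' - θ) ^ 2 * Real.exp ((θ' - θ) * n) := by
    rw [div_mul_eq_mul_div, le_div_iff₀ (by positivity)]
    norm_num at h1
    nlinarith
  calc _ ≤ 2 / (θ' - θ) ^ 2 * Real.exp ((θ' - θ) * n) * Real.exp (θ * n) := by gcongr
    _ = _ := by
      rw [mul_assoc, ← Real.exp_add]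
      ring_nf

/-- Multiplying out removes the division and covers β = 0, where the existence time is ∞ and the
right side reads 0 < θ' - θ. -/
theorem ofReal_lt_existenceTime_iff {θ θ' : ℝ}
    (h : θ < θ') {t : ℝ} (ht : 0 ≤ t) :
    ENNReal.ofReal t < existenceTime c₁ c₂ φ θ' θ ↔ t * β c₁ c₂ φ θ' < θ' - θ := by
  have hδ : 0 < θ' - θ := sub_pos.2 h
  rw [existenceTime, ENNReal.lt_div_iff_mul_lt (Or.inr ENNReal.ofReal_ne_top) (Or.inl ENNReal.ofReal_ne_top),
    ← ENNReal.ofReal_mul ht, ENNReal.ofReal_lt_ofReal_iff hδ]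

section Regularity

variable [NeZero d] (hm : ModelAssumptions c₁ c₂ φ)
include hm

/-- Ψ costs at most |η|² and B at most |η|; any gap between the exponents absorbs both, so L^Δ is
bounded from 𝒦_θ to 𝒦_{θ'}. -/
theorem exists_Ψ_offDiagonal_le {θ θ' : ℝ} (h : θ < θ') : ∃ A, 0 ≤ A ∧
    ∀ C k, WeightBound θ C k → ∀ η : Config d,
      Ψ c₁ η * |k η| ≤ A * C * Real.exp (θ' * η.card) ∧
      |offDiagonal c₁ c₂ φ k η| ≤ A * C * Real.exp (θ' * η.card) := by
  obtain ⟨A, hA0, hA⟩ := exists_sq_mul_exp_le h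
  obtain ⟨D, hD0, hD⟩ := exists_Ψ_le hm
  have hβ := β_nonneg hm θ
  refine ⟨(D + β c₁ c₂ φ θ) * A, by positivity, fun C k hk η => ?_⟩
  have hC := hk.nonneg
  have hA' := mul_le_mul_of_nonneg_left (hA η.card) hC
  have hpos : 0 ≤ C * (A * Real.exp (θ' * η.card)) := by positivity
  constructor
  · calc _ ≤ (D * (η.card : ℝ) ^ 2) * (C * Real.exp (θ * η.card)) :=
          mul_le_mul (hD η) (hk.le η) (abs_nonneg _) (by positivity)
      _ = D * (C * ((η.card : ℝ) ^ 2 * Real.exp (θ * η.card))) := by ring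
      _ ≤ D * (C * (A * Real.exp (θ' * η.card))) := by gcongr
      _ ≤ _ := by nlinarith [mul_nonneg hβ hpos]
  · have h1 : (η.card : ℝ) ≤ (η.card : ℝ) ^ 2 := by exact_mod_cast Nat.le_self_pow two_ne_zero _
    calc _ ≤ C * β c₁ c₂ φ θ * (η.card * Real.exp (θ * η.card)) := abs_offDiagonal_le hm hk η
      _ ≤ C * β c₁ c₂ φ θ * ((η.card : ℝ) ^ 2 * Real.exp (θ * η.card)) := by gcongr
      _ = β c₁ c₂ φ θ * (C * ((η.card : ℝ) ^ 2 * Real.exp (θ * η.card))) := by ring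
      _ ≤ β c₁ c₂ φ θ * (C * (A * Real.exp (θ' * η.card))) := by gcongr
      _ ≤ _ := by nlinarith [mul_nonneg hD0 hpos]

theorem exists_LΔ_le {θ θ' : ℝ} (h : θ < θ') : ∃ A, 0 ≤ A ∧
    ∀ C k, WeightBound θ C k → WeightBound (d := d) θ' (A * C) (LΔ c₁ c₂ φ k) := by
  obtain ⟨A, hA0, hA⟩ := exists_Ψ_offDiagonal_le hm h
  refine ⟨2 * A, by positivity, fun C k hk => ⟨?_, fun η => ?_⟩⟩
  · rw [show LΔ c₁ c₂ φ k = fun η => -(Ψ c₁ η * k η) + offDiagonal c₁ c₂ φ k η from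
      funext (LΔ_eq k)]
    exact ((measurable_Ψ hm).mul hk.measurable).neg.add (measurable_offDiagonal hm hk.measurable)
  · rw [LΔ_eq]
    refine (abs_add_le _ _).trans ?_
    rw [abs_neg, abs_mul, abs_of_nonneg (Ψ_nonneg hm η)]
    linarith [(hA C k hk η).1, (hA C k hk η).2]

theorem LΔ_sub {θ C C' : ℝ} {k k' : Config d → ℝ} (hk : WeightBound θ C k)
    (hk' : WeightBound θ C' k') (η : Config d) :
    LΔ c₁ c₂ φ (fun ζ => k ζ - k' ζ) η = LΔ c₁ c₂ φ k η - LΔ c₁ c₂ φ k' η := by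
  rw [LΔ_eq, LΔ_eq, LΔ_eq, offDiagonal_sub hm hk hk']
  ring

variable {θ θ' τ K : ℝ} (hu : JointlyMeasurable u)
  (hsol : ∀ t ∈ Icc 0 τ, WeightBound θ K (u t) ∧ ∀ η, u t η = picardMap c₁ c₂ φ k₀ u t η)
include hu hsol

theorem duhamel_step {s t : ℝ} (hs : 0 ≤ s) (hst : s ≤ t) (ht : t ≤ τ) (η : Config d) :
    u t η = Real.exp (-((t - s) * Ψ c₁ η)) * u s η + Real.exp (-(t * Ψ c₁ η)) *
      ∫ r in Ioc s t, Real.exp (r * Ψ c₁ η) * offDiagonal c₁ c₂ φ (u r) η := by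
  have hint := integrableOn_exp_mul_offDiagonal hm hu (fun r hr => (hsol r hr).1) η
  have h1 : ∫ r in Ioc 0 t, Real.exp (r * Ψ c₁ η) * offDiagonal c₁ c₂ φ (u r) η =
      (∫ r in Ioc 0 s, Real.exp (r * Ψ c₁ η) * offDiagonal c₁ c₂ φ (u r) η) +
        ∫ r in Ioc s t, Real.exp (r * Ψ c₁ η) * offDiagonal c₁ c₂ φ (u r) η := by
    rw [← setIntegral_union (Ioc_disjoint_Ioc_of_le le_rfl) measurableSet_Ioc
      (hint.mono_set (Ioc_subset_Ioc_right (hst.trans ht)))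
      (hint.mono_set (Ioc_subset_Ioc hs ht)), Ioc_union_Ioc_eq_Ioc hs hst]
  rw [(hsol t ⟨hs.trans hst, ht⟩).2, (hsol s ⟨hs, hst.trans ht⟩).2, picardMap, picardMap, h1,
    show -(t * Ψ c₁ η) = -((t - s) * Ψ c₁ η) + -(s * Ψ c₁ η) by ring, Real.exp_add]
  ring

/-- By the Duhamel formula restarted at s, the increment consists of (e^{-(t-s)Ψ} - 1)u_s, at most
(t-s)Ψ|u_s|, and an integral of B u_r over an interval of length t - s. -/
theorem exists_lipschitz (hθ : θ < θ') : ∃ K', 0 ≤ K' ∧ ∀ s ∈ Icc 0 τ, ∀ t ∈ Icc 0 τ,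
    ∀ η, |u t η - u s η| ≤ |t - s| * K' * Real.exp (θ' * η.card) := by
  obtain ⟨A, hA0, hA⟩ := exists_Ψ_offDiagonal_le hm hθ
  rcases lt_or_ge τ 0 with hτ | hτ
  · exact ⟨0, le_rfl, fun s hs => absurd (hs.1.trans hs.2) (not_le.2 hτ)⟩
  have hK : 0 ≤ K := (hsol 0 ⟨le_rfl, hτ⟩).1.nonneg
  refine ⟨2 * A * K, by positivity, ?_⟩
  have key : ∀ s t, 0 ≤ s → s ≤ t → t ≤ τ → ∀ η,
      |u t η - u s η| ≤ |t - s| * (2 * A * K) * Real.exp (θ' * η.card) := by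
    intro s t hs hst ht η
    have hΨ := Ψ_nonneg hm η
    have hts : 0 ≤ t - s := sub_nonneg.2 hst
    set E := A * K * Real.exp (θ' * η.card) with hE
    have h1 : |Real.exp (-((t - s) * Ψ c₁ η)) * u s η - u s η| ≤ (t - s) * E := by
      have e1 : Real.exp (-((t - s) * Ψ c₁ η)) ≤ 1 :=
        Real.exp_le_one_iff.2 (by linarith [mul_nonneg hts hΨ])
      have e2 := Real.add_one_le_exp (-((t - s) * Ψ c₁ η))
      rw [← sub_one_mul, abs_mul, abs_of_nonpos (by linarith)]
      calc _ ≤ ((t - s) * Ψ c₁ η) * |u s η| := by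
            gcongr
            linarith
        _ = (t - s) * (Ψ c₁ η * |u s η|) := by ring
        _ ≤ _ := mul_le_mul_of_nonneg_left (hA K _ (hsol s ⟨hs, hst.trans ht⟩).1 η).1 hts
    have h2 : ‖∫ r in Ioc s t, Real.exp (r * Ψ c₁ η) * offDiagonal c₁ c₂ φ (u r) η‖ ≤
        Real.exp (t * Ψ c₁ η) * E * (t - s) := by
      have := norm_setIntegral_le_of_norm_le_const (μ := volume) (s := Ioc s t)
        (C := Real.exp (t * Ψ c₁ η) * E)
        (f := fun r => Real.exp (r * Ψ c₁ η) * offDiagonal c₁ c₂ φ (u r) η) (by simp) ?_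
      · rwa [Real.volume_real_Ioc_of_le hst] at this
      · intro r hr
        rw [norm_mul, Real.norm_eq_abs, Real.norm_eq_abs, Real.abs_exp]
        have h3 := (hA K _ (hsol r ⟨hs.trans hr.1.le, hr.2.trans ht⟩).1 η).2
        refine mul_le_mul ?_ h3 (abs_nonneg _) (Real.exp_pos _).le
        gcongr
        exact hr.2
    have h3 : |Real.exp (-(t * Ψ c₁ η)) *
        ∫ r in Ioc s t, Real.exp (r * Ψ c₁ η) * offDiagonal c₁ c₂ φ (u r) η| ≤ (t - s) * E := by
      rw [abs_mul, Real.abs_exp]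
      calc _ ≤ Real.exp (-(t * Ψ c₁ η)) * (Real.exp (t * Ψ c₁ η) * E * (t - s)) :=
            mul_le_mul_of_nonneg_left h2 (Real.exp_pos _).le
        _ = (Real.exp (-(t * Ψ c₁ η)) * Real.exp (t * Ψ c₁ η)) * ((t - s) * E) := by ring
        _ = _ := by rw [← Real.exp_add, neg_add_cancel, Real.exp_zero, one_mul]
    rw [duhamel_step hm hu hsol hs hst ht η, abs_of_nonneg hts, add_sub_right_comm]
    refine (abs_add_le _ _).trans ((add_le_add h1 h3).trans_eq ?_)
    rw [hE]
    ring
  intro s hs t ht η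
  rcases le_total s t with h | h
  · exact key s t hs.1 h ht.2 η
  · rw [abs_sub_comm (u t η), abs_sub_comm t]
    exact key t s ht.1 h hs.2 η

theorem exists_LΔ_lipschitz (hθ : θ < θ') : ∃ K', 0 ≤ K' ∧ ∀ s ∈ Icc 0 τ, ∀ t ∈ Icc 0 τ,
    ∀ η, |LΔ c₁ c₂ φ (u t) η - LΔ c₁ c₂ φ (u s) η| ≤ |t - s| * K' * Real.exp (θ' * η.card) := by
  -- The gap is spent in two halves: one on the Lipschitz bound for u, the other on applying L^Δ to
  -- the increment.
  obtain ⟨θ₁, h1, h2⟩ := exists_between hθ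
  obtain ⟨L, hL0, hL⟩ := exists_lipschitz hm hu hsol h1
  obtain ⟨A, hA0, hA⟩ := exists_LΔ_le hm h2
  refine ⟨A * L, by positivity, fun s hs t ht η => ?_⟩
  have hw : WeightBound θ₁ (|t - s| * L) fun ζ => u t ζ - u s ζ :=
    ⟨(hsol t ht).1.measurable.sub (hsol s hs).1.measurable, hL s hs t ht⟩
  have := (hA _ _ hw).le η
  rw [LΔ_sub hm (hsol t ht).1 (hsol s hs).1] at this
  exact this.trans_eq (by ring)

theorem hasDerivAt_duhamel {t : ℝ} (ht : t ∈ Ioo 0 τ) (η : Config d) :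
    HasDerivAt (fun s => u s η) (LΔ c₁ c₂ φ (u t) η) t := by
  obtain ⟨L, hL0, hL⟩ := exists_lipschitz hm hu hsol (lt_add_one θ)
  -- Continuity of the integrand is what the fundamental theorem of calculus needs; at a fixed η any
  -- larger exponent serves, here θ + 1.
  have hB : ContinuousOn (fun s => offDiagonal c₁ c₂ φ (u s) η) (Icc 0 τ) := by
    have hlip : LipschitzOnWith (Real.toNNReal (L * β c₁ c₂ φ (θ + 1) *
        (η.card * Real.exp ((θ + 1) * η.card)))) (fun s => offDiagonal c₁ c₂ φ (u s) η)
        (Icc 0 τ) := by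
      have hβ := β_nonneg hm (θ + 1)
      refine LipschitzOnWith.of_dist_le_mul fun s hs r hr => ?_
      have hw : WeightBound (θ + 1) (|s - r| * L) fun ζ => u s ζ - u r ζ :=
        ⟨(hsol s hs).1.measurable.sub (hsol r hr).1.measurable, hL r hr s hs⟩
      have := abs_offDiagonal_le hm hw η
      rw [offDiagonal_sub hm (hsol s hs).1 (hsol r hr).1] at this
      rw [Real.dist_eq, Real.dist_eq, Real.coe_toNNReal _ (by positivity)]
      exact this.trans_eq (by ring)
    exact hlip.continuousOn
  set f : ℝ → ℝ := fun s => Real.exp (s * Ψ c₁ η) * offDiagonal c₁ c₂ φ (u s) η with hf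
  have hfc : ContinuousOn f (Icc 0 τ) := ContinuousOn.mul (by fun_prop) hB
  have hfm : Measurable f :=
    Measurable.mul (by fun_prop) ((hu.offDiagonal hm).measurable_left η)
  have hI : HasDerivAt (fun s => ∫ r in (0 : ℝ)..s, f r) (f t) t := by
    refine intervalIntegral.integral_hasDerivAt_right ?_
      hfm.stronglyMeasurable.stronglyMeasurableAtFilter
      (hfc.continuousAt (Icc_mem_nhds ht.1 ht.2))
    refine ContinuousOn.intervalIntegrable_of_Icc ht.1.le
      (hfc.mono (Icc_subset_Icc_right ht.2.le))
  have hE : HasDerivAt (fun s => Real.exp (-(s * Ψ c₁ η)))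
      (Real.exp (-(t * Ψ c₁ η)) * -(Ψ c₁ η)) t := by
    have : HasDerivAt (fun s => -(s * Ψ c₁ η)) (-(Ψ c₁ η)) t := by
      have h1 := ((hasDerivAt_id t).mul_const (Ψ c₁ η)).neg
      rw [one_mul] at h1
      exact h1
    exact this.exp
  have hmain := hE.mul (hI.const_add (k₀ η))
  have hval : ∀ s ∈ Icc 0 τ, u s η =
      Real.exp (-(s * Ψ c₁ η)) * (k₀ η + ∫ r in (0 : ℝ)..s, f r) := by
    intro s hs
    rw [(hsol s hs).2, picardMap, intervalIntegral.integral_of_le hs.1]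
  have hev : (fun s => u s η) =ᶠ[𝓝 t]
      fun s => Real.exp (-(s * Ψ c₁ η)) * (k₀ η + ∫ r in (0 : ℝ)..s, f r) := by
    filter_upwards [Icc_mem_nhds ht.1 ht.2] with s hs using hval s hs
  refine (hmain.congr_of_eventuallyEq hev).congr_deriv ?_
  have hcancel : Real.exp (-(t * Ψ c₁ η)) * Real.exp (t * Ψ c₁ η) = 1 := by
    rw [← Real.exp_add, neg_add_cancel, Real.exp_zero]
  rw [LΔ_eq, hval t ⟨ht.1.le, ht.2.le⟩, hf]
  linear_combination (offDiagonal c₁ c₂ φ (u t) η) * hcancel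

/-- The mean value inequality for s ↦ u_s - s L^Δ u_t, whose derivative is small because L^Δ u is
Lipschitz. The remainder is quadratic with the weight e^{θ'|η|} factored out, so it passes to the
norm. -/
theorem abs_taylor_le {K' : ℝ} (hK' : ∀ s ∈ Icc 0 τ, ∀ t ∈ Icc 0 τ,
    ∀ η, |LΔ c₁ c₂ φ (u t) η - LΔ c₁ c₂ φ (u s) η| ≤ |t - s| * K' * Real.exp (θ' * η.card))
    (hK0 : 0 ≤ K') {t z : ℝ} (ht : t ∈ Ioo 0 τ) (hz : z ∈ Ioo 0 τ) (η : Config d) :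
    |u z η - u t η - (z - t) * LΔ c₁ c₂ φ (u t) η| ≤
      |z - t| * K' * |z - t| * Real.exp (θ' * η.card) := by
  have hsub : uIcc t z ⊆ Ioo 0 τ := by
    intro s hs
    rcases le_total t z with h | h
    · rw [uIcc_of_le h] at hs
      exact ⟨ht.1.trans_le hs.1, hs.2.trans_lt hz.2⟩
    · rw [uIcc_of_ge h] at hs
      exact ⟨hz.1.trans_le hs.1, hs.2.trans_lt ht.2⟩
  have := Convex.norm_image_sub_le_of_norm_hasDerivWithin_le
    (f := fun s => u s η - s * LΔ c₁ c₂ φ (u t) η)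
    (f' := fun s => LΔ c₁ c₂ φ (u s) η - LΔ c₁ c₂ φ (u t) η) (s := uIcc t z) (x := t) (y := z)
    (C := |z - t| * K' * Real.exp (θ' * η.card)) ?_ ?_ (convex_uIcc t z)
    left_mem_uIcc right_mem_uIcc
  · rw [Real.norm_eq_abs, Real.norm_eq_abs] at this
    calc _ = |u z η - z * LΔ c₁ c₂ φ (u t) η - (u t η - t * LΔ c₁ c₂ φ (u t) η)| := by
          congr 1
          ring
      _ ≤ _ := this
      _ = _ := by ring
  · intro s hs
    have h1 := (hasDerivAt_duhamel hm hu hsol (hsub hs) η).sub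
      ((hasDerivAt_id s).mul_const (LΔ c₁ c₂ φ (u t) η))
    rw [one_mul] at h1
    exact h1.hasDerivWithinAt
  · intro s hs
    have h1 := hK' t (Ioo_subset_Icc_self ht) s (Ioo_subset_Icc_self (hsub hs)) η
    refine h1.trans ?_
    have h2 : |s - t| ≤ |z - t| := abs_sub_left_of_mem_uIcc hs
    gcongr

end Regularity

open Classical in
/-- The curve in `𝒦_{α'}` given by a family of functions (by zero where they are not bounded). -/
def toKSpace (α' : ℝ) (u : ℝ → Config d → ℝ) (t : ℝ) : KSpace d α' :=
  if h : ∃ C, WeightBound α' C (u t) then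
    KSpace.ofBound (u t) h.choose_spec.measurable.aestronglyMeasurable
      (Eventually.of_forall h.choose_spec.le)
  else 0

theorem coe_toKSpace {α' C t : ℝ} (h : WeightBound α' C (u t)) :
    (toKSpace α' u t).1 =ᵐ[lebesguePoisson d] u t := by
  have h' : ∃ C, WeightBound α' C (u t) := ⟨C, h⟩
  rw [toKSpace, dif_pos h']
  exact KSpace.coe_ofBound

/-! ### The classical solution in 𝒦_{α'} -/

section Solution

variable (hm : ModelAssumptions c₁ c₂ φ) {α' τ K θ : ℝ}
  (hu : JointlyMeasurable u)
  (hsol : ∀ t ∈ Icc 0 τ, WeightBound θ K (u t) ∧ ∀ η, u t η = picardMap c₁ c₂ φ k₀ u t η)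
  (hθ : θ < α')
include hsol hθ

theorem coe_toKSpace_of_mem {t : ℝ} (ht : t ∈ Icc 0 τ) :
    (toKSpace α' u t).1 =ᵐ[lebesguePoisson d] u t :=
  coe_toKSpace ((hsol t ht).1.mono hθ.le le_rfl)

theorem toKSpace_mem_domain {t : ℝ} (ht : t ∈ Icc 0 τ) : toKSpace α' u t ∈ KDomain d α' := by
  obtain ⟨A, hA0, hA⟩ := exists_sq_mul_exp_le hθ
  have hK := (hsol t ht).1.nonneg
  refine ⟨A * K + 1, by positivity, ?_⟩
  filter_upwards [coe_toKSpace_of_mem hsol hθ ht] with η hη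
  rw [hη]
  calc _ ≤ (η.card : ℝ) ^ 2 * (K * Real.exp (θ * η.card)) :=
        mul_le_mul_of_nonneg_left ((hsol t ht).1.le η) (by positivity)
    _ = K * ((η.card : ℝ) ^ 2 * Real.exp (θ * η.card)) := by ring
    _ ≤ K * (A * Real.exp (α' * η.card)) := mul_le_mul_of_nonneg_left (hA _) hK
    _ ≤ _ := by nlinarith [Real.exp_pos (α' * η.card)]

variable [NeZero d]
include hm

theorem coe_toKSpace_LΔ {t : ℝ} (ht : t ∈ Icc 0 τ) :
    (toKSpace α' (fun s => LΔ c₁ c₂ φ (u s)) t).1 =ᵐ[lebesguePoisson d] LΔ c₁ c₂ φ (u t) := by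
  obtain ⟨A, hA0, hA⟩ := exists_LΔ_le hm hθ
  exact coe_toKSpace (u := fun s => LΔ c₁ c₂ φ (u s)) (hA K _ (hsol t ht).1)

include hu

theorem continuousOn_toKSpace : ContinuousOn (toKSpace α' u) (Icc 0 τ) := by
  obtain ⟨L, hL0, hL⟩ := exists_lipschitz hm hu hsol hθ
  refine LipschitzOnWith.continuousOn (K := Real.toNNReal L)
    (LipschitzOnWith.of_dist_le_mul fun t ht s hs => ?_)
  rw [dist_eq_norm, Real.dist_eq, Real.coe_toNNReal _ hL0, KSpace.norm_le_iff (by positivity)]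
  filter_upwards [coe_toKSpace_of_mem hsol hθ ht, coe_toKSpace_of_mem hsol hθ hs,
    KSpace.coe_sub (toKSpace α' u t) (toKSpace α' u s)] with η h1 h2 h3
  rw [h3, h1, h2]
  exact (hL s hs t ht η).trans_eq (by ring)

theorem continuousOn_toKSpace_LΔ :
    ContinuousOn (toKSpace α' fun s => LΔ c₁ c₂ φ (u s)) (Icc 0 τ) := by
  obtain ⟨L, hL0, hL⟩ := exists_LΔ_lipschitz hm hu hsol hθ
  refine LipschitzOnWith.continuousOn (K := Real.toNNReal L)
    (LipschitzOnWith.of_dist_le_mul fun t ht s hs => ?_)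
  rw [dist_eq_norm, Real.dist_eq, Real.coe_toNNReal _ hL0, KSpace.norm_le_iff (by positivity)]
  filter_upwards [coe_toKSpace_LΔ hm hsol hθ ht, coe_toKSpace_LΔ hm hsol hθ hs,
    KSpace.coe_sub (toKSpace α' (fun s => LΔ c₁ c₂ φ (u s)) t)
      (toKSpace α' (fun s => LΔ c₁ c₂ φ (u s)) s)] with η h1 h2 h3
  rw [h3, h1, h2]
  exact (hL s hs t ht η).trans_eq (by ring)

theorem hasDerivAt_toKSpace {t : ℝ} (ht : t ∈ Ioo 0 τ) :
    HasDerivAt (toKSpace α' u) (toKSpace α' (fun s => LΔ c₁ c₂ φ (u s)) t) t := by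
  obtain ⟨L, hL0, hL⟩ := exists_LΔ_lipschitz hm hu hsol hθ
  have hbound : ∀ z ∈ Ioo 0 τ, ‖toKSpace α' u z - toKSpace α' u t -
      (z - t) • toKSpace α' (fun s => LΔ c₁ c₂ φ (u s)) t‖ ≤ |z - t| * L * |z - t| := by
    intro z hz
    rw [KSpace.norm_le_iff (by positivity)]
    filter_upwards [coe_toKSpace_of_mem hsol hθ (Ioo_subset_Icc_self hz),
      coe_toKSpace_of_mem hsol hθ (Ioo_subset_Icc_self ht),
      coe_toKSpace_LΔ hm hsol hθ (Ioo_subset_Icc_self ht),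
      KSpace.coe_sub (toKSpace α' u z - toKSpace α' u t)
        ((z - t) • toKSpace α' (fun s => LΔ c₁ c₂ φ (u s)) t),
      KSpace.coe_sub (toKSpace α' u z) (toKSpace α' u t),
      AEEqFun.coeFn_smul (z - t) (toKSpace α' (fun s => LΔ c₁ c₂ φ (u s)) t).1]
      with η h1 h2 h3 h4 h5 h6
    have h6' : ((z - t) • toKSpace α' (fun s => LΔ c₁ c₂ φ (u s)) t).1 η =
      (z - t) * (toKSpace α' (fun s => LΔ c₁ c₂ φ (u s)) t).1 η := h6
    rw [h4, h5, h6', h1, h2, h3]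
    exact abs_taylor_le hm hu hsol hL hL0 ht hz η
  rw [hasDerivAt_iff_isLittleO, Asymptotics.isLittleO_iff]
  intro c hc
  have hnear : ∀ᶠ z in 𝓝 t, |z - t| * L < c := by
    have hcont : ContinuousAt (fun z => |z - t| * L) t := by fun_prop
    exact hcont.eventually_lt continuousAt_const (by simpa using hc)
  filter_upwards [hnear, Ioo_mem_nhds ht.1 ht.2] with z h1 h2
  rw [Real.norm_eq_abs]
  exact (hbound z h2).trans (mul_le_mul_of_nonneg_right h1.le (abs_nonneg _))

end Solution

theorem exists_isClassicalSolution [NeZero d] (hm : ModelAssumptions c₁ c₂ φ) {α₀ α' : ℝ}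
    (hα : α₀ < α') (k₀ : KSpace d α₀) : ∃ k : ℝ → KSpace d α',
      IsClassicalSolution c₁ c₂ φ α' (existenceTime c₁ c₂ φ α' α₀) k₀.1 k := by
  obtain ⟨f, hf, hkf⟩ := KSpace.exists_weightBound (norm_nonneg k₀) (KSpace.ae_le_norm k₀)
  set u := duhamelSolution c₁ c₂ φ f with hu_def
  have hu : JointlyMeasurable u := jointlyMeasurable_duhamelSolution hm hf.measurable
  -- The condition τβ(α') < α' - α₀ is open, so each admissible t lies below an admissible τ. The
  -- exponent θ < α' depends on τ, but the function u does not, and all properties to be shown are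
  -- local in time.
  have hlocal : ∀ t, 0 ≤ t → ENNReal.ofReal t < existenceTime c₁ c₂ φ α' α₀ →
      ∃ τ, t < τ ∧ ∃ θ < α', ∃ K, ∀ t ∈ Icc 0 τ, WeightBound θ K (u t) ∧
        ∀ η, u t η = picardMap c₁ c₂ φ f u t η := by
    intro t ht0 ht
    rw [ofReal_lt_existenceTime_iff hα ht0] at ht
    have hc : ContinuousAt (fun τ => τ * β c₁ c₂ φ α') t := by fun_prop
    have h1 := (hc.eventually_lt continuousAt_const ht).filter_mono
      (nhdsWithin_le_nhds (s := Ioi t))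
    obtain ⟨τ, hτ, hτt⟩ := (h1.and self_mem_nhdsWithin).exists
    exact ⟨τ, hτt, exists_duhamelSolution_bound hm hf (ht0.trans hτt.le) hτ⟩
  have hderiv : ∀ t, 0 < t → ENNReal.ofReal t < existenceTime c₁ c₂ φ α' α₀ →
      HasDerivAt (toKSpace α' u) (toKSpace α' (fun s => LΔ c₁ c₂ φ (u s)) t) t := by
    intro t ht0 ht
    obtain ⟨τ, hτ, θ, hθ, K, hK⟩ := hlocal t ht0.le ht
    exact hasDerivAt_toKSpace hm hu hK hθ ⟨ht0, hτ⟩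
  refine ⟨toKSpace α' u, ⟨?_, ?_, ?_, ?_, ?_, ?_⟩⟩
  · rintro t ⟨ht0, ht⟩
    obtain ⟨τ, hτ, θ, hθ, K, hK⟩ := hlocal t ht0 ht
    refine (continuousOn_toKSpace hm hu hK hθ t ⟨ht0, hτ.le⟩).mono_of_mem_nhdsWithin ?_
    filter_upwards [self_mem_nhdsWithin, nhdsWithin_le_nhds (Iio_mem_nhds hτ)] with s hs hs'
    exact ⟨hs.1, hs'.le⟩
  · intro t ht0 ht
    obtain ⟨τ, hτ, θ, hθ, K, hK⟩ := hlocal t ht0 ht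
    exact toKSpace_mem_domain hK hθ ⟨ht0, hτ.le⟩
  · exact fun t ht0 ht => (hderiv t ht0 ht).differentiableAt
  · have h1 : ContinuousOn (toKSpace α' fun s => LΔ c₁ c₂ φ (u s))
        {t | 0 < t ∧ ENNReal.ofReal t < existenceTime c₁ c₂ φ α' α₀} := by
      rintro t ⟨ht0, ht⟩
      obtain ⟨τ, hτ, θ, hθ, K, hK⟩ := hlocal t ht0.le ht
      exact ((continuousOn_toKSpace_LΔ hm hu hK hθ).continuousAt
        (Icc_mem_nhds ht0 hτ)).continuousWithinAt
    exact h1.congr fun t ht => (hderiv t ht.1 ht.2).deriv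
  · intro t ht0 ht
    obtain ⟨τ, hτ, θ, hθ, K, hK⟩ := hlocal t ht0.le ht
    -- The derivative is the class of L^Δ applied to the function u_t; that L^Δ respects λ-classes
    -- replaces u_t by its class.
    rw [(hderiv t ht0 ht).deriv]
    exact (coe_toKSpace_LΔ hm hK hθ ⟨ht0.le, hτ.le⟩).trans
      (LΔ_congr (coe_toKSpace_of_mem hK hθ ⟨ht0.le, hτ.le⟩)).symm
  · have h0 : ENNReal.ofReal 0 < existenceTime c₁ c₂ φ α' α₀ := by
      rw [ofReal_lt_existenceTime_iff hα le_rfl]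
      linarith
    obtain ⟨τ, hτ, θ, hθ, K, hK⟩ := hlocal 0 le_rfl h0
    refine AEEqFun.ext ((coe_toKSpace_of_mem hK hθ ⟨le_rfl, hτ.le⟩).trans ?_)
    refine EventuallyEq.trans ?_ hkf.symm
    refine Eventually.of_forall fun η => ?_
    rw [(hK 0 ⟨le_rfl, hτ.le⟩).2 η]
    simp [picardMap]

end

end JumpCoalescence

end

theorem theorem1 (d : ℕ) (hd : 1 ≤ d)
    (c₁ : Space d → Space d → Space d → ℝ) (c₂ φ : Space d → ℝ)
    (hmodel : ModelAssumptions c₁ c₂ φ)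
    (α₀ αs : ℝ) (hα : α₀ < αs) (k₀ : KSpace d α₀) :
    ∃ k : ℝ → KSpace d αs,
      IsClassicalSolution c₁ c₂ φ αs (existenceTime c₁ c₂ φ αs α₀) k₀.1 k ∧
      ∀ k' : ℝ → KSpace d αs,
        IsClassicalSolution c₁ c₂ φ αs (existenceTime c₁ c₂ φ αs α₀) k₀.1 k' →
        ∀ t : ℝ, 0 ≤ t → ENNReal.ofReal t < existenceTime c₁ c₂ φ αs α₀ → k' t = k t := by
  have : NeZero d := ⟨by omega⟩
  obtain ⟨k, hk⟩ := exists_isClassicalSolution hmodel hα k₀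
  exact ⟨k, hk, fun k' hk' t ht0 ht => hk.unique hmodel hk' t ht0 ht⟩
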